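/- Let $D^{2,2,2}$ be the modular lattice with unity $I$ generated by $x_1,y_1,x_2,y_2,x_3,y_3$ subject only to $x_i\subseteq y_i$ ($i=1,2,3$); write $+$ and juxtaposition for its two operations (sum and intersection). **Representations and elementary maps.** A representation $\rho$ of $D^{2,2,2}$ in a vector space $X_0$ over a field is a lattice morphism from $D^{2,2,2}$ to the lattice of linear subspaces of $X_0$ with $\rho(I)=X_0$. Put $X_i=\rho(x_i)$, $Y_i=\rho(y_i)$ and $$X_0^1=\{(\eta_1,\eta_2,\eta_3)\mid \eta_i\in Y_i,\ \eta_1+\eta_2+\eta_3=0\}.$$ $\Phi^+\rho$ is the representation in $X_0^1$ with $\Phi^+\rho(x_i)=\{\eta\in X_0^1\mid \eta_i=0\}$ and $\Phi^+\rho(y_i)=\{\eta\in X_0^1\mid\eta_i\in X_i\}$, and $\varphi_i:X_0^1\to X_0$ is the linear map $(\eta_1,\eta_2,\eta_3)\mapsto\eta_i$. **Atomic elements.** For $\{i,j,k\}=\{1,2,3\}$ let $a_0^{ij}=A_0^{ij}=I$ and, for $n\ge1$, $a_n^{ij}=x_i+y_ja_{n-1}^{jk}$, $A_n^{ij}=y_i+x_jA_{n-1}^{ki}$.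 **Admissible sequences and elements.** A sequence $\alpha=i_n\dots i_2i_1$ of indices in $\{1,2,3\}$ is admissible if adjacent indices are distinct; its length is $n$ and it starts at $i_1$. Two sequences are identified if they are connected by replacements $\dots iji\dots=\dots iki\dots$ with $i,j,k$ distinct. The elements $f_\alpha,e_\alpha,g_{\alpha0}$ of an admissible sequence are defined by bringing $\alpha$ to one of the following normal forms, or to one obtained from these by a permutation of the indices $1,2,3$ (applied simultaneously to the sequence and to the elements). Here $q=k+3p$, $p\ge0$; $\gamma=(213)^{2p}(21)^{2k}$ with $k>0$; $\beta=(213)^{2p}(21)^{2k+1}$ with $k\ge0$; in the lines for $1(21)^{2k}$ and $1(21)^{2k+1}$, $k\ge0$. In every line $g_{\alpha0}=e_\alpha h_\alpha$. | $\alpha$ | $f_\alpha$ | $e_\alpha$ | $h_\alpha$ | |---|---|---|---| | $\gamma$ | $y_1y_2a^{13}_qA^{32}_{k-1}$ | $y_2A^{32}_{k-1}a^{21}_qA^{13}_ka^{13}_q$ | $x_1+a^{32}_qA^{32}_k$ | | $3\gamma$ | $y_3(x_1+x_2)A^{23}_qa^{31}_{k-1}$ | $y_3a^{31}_{k-1}A^{12}_{q+1}a^{12}_kA^{23}_q$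 | $y_2y_3+A^{12}_qa^{31}_k$ | | $13\gamma$ | $y_3y_1a^{32}_{q+1}A^{21}_{k-1}$ | $y_1A^{21}_{k-1}a^{13}_{q+1}A^{32}_ka^{32}_{q+1}$ | $x_3+a^{21}_{q+1}A^{21}_k$ | | $(213)\gamma$ | $y_2(x_3+x_1)A^{12}_{q+1}a^{23}_{k-1}$ | $y_2a^{23}_{k-1}A^{31}_{q+2}a^{31}_kA^{12}_{q+1}$ | $y_1y_2+A^{31}_{q+1}a^{23}_k$ | | $3(213)\gamma$ | $y_2y_3a^{21}_{q+2}A^{13}_{k-1}$ | $y_3A^{13}_{k-1}a^{32}_{q+2}A^{21}_ka^{21}_{q+2}$ | $x_2+a^{13}_{q+2}A^{13}_k$ | | $13(213)\gamma$ | $y_1(x_2+x_3)A^{31}_{q+2}a^{12}_{k-1}$ | $y_1a^{12}_{k-1}A^{23}_{q+3}a^{23}_kA^{31}_{q+2}$ | $y_1y_3+A^{23}_{q+2}a^{12}_k$ | | $1(21)^{2k}$ | $x_1A^{23}_ka^{23}_k$ | $y_1A^{31}_ka^{12}_kA^{23}_ka^{23}_k$ | $y_2a^{21}_k+y_3a^{31}_k$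 | | $1(21)^{2k+1}$ | $y_1(x_2+x_3)A^{31}_ka^{12}_k$ | $y_1A^{31}_ka^{12}_kA^{23}_{k+1}a^{23}_{k+1}$ | $y_1a^{12}_{k+1}+y_1a^{13}_{k+1}$ | | $\beta$ | $y_2y_3a^{21}_qA^{13}_k$ | $y_2A^{32}_ka^{21}_qA^{13}_ka^{13}_{q+1}$ | $x_2+a^{13}_qA^{13}_{k+1}$ | | $3\beta$ | $x_3A^{12}_{q+1}a^{12}_k$ | $y_3a^{31}_kA^{12}_{q+1}a^{12}_kA^{23}_{q+1}$ | $y_1y_3+A^{23}_qa^{12}_{k+1}$ | | $13\beta$ | $y_1y_2a^{13}_{q+1}A^{32}_k$ | $y_1A^{21}_ka^{13}_{q+1}A^{32}_ka^{32}_{q+2}$ | $x_1+a^{32}_{q+1}A^{32}_{k+1}$ | | $(213)\beta$ | $x_2A^{31}_{q+2}a^{31}_k$ | $y_2a^{23}_kA^{31}_{q+2}a^{31}_kA^{12}_{q+2}$ | $y_2y_3+A^{12}_{q+1}a^{31}_{k+1}$ | | $3(213)\beta$ | $y_3y_1a^{32}_{q+2}A^{21}_k$ | $y_3A^{13}_ka^{32}_{q+2}A^{21}_ka^{21}_{q+3}$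 | $x_3+a^{21}_{q+2}A^{21}_{k+1}$ | | $13(213)\beta$ | $x_1A^{23}_{q+3}a^{23}_k$ | $y_1a^{12}_kA^{23}_{q+3}a^{23}_kA^{31}_{q+3}$ | $y_1y_2+A^{31}_{q+2}a^{23}_{k+1}$ | Moreover $g_0=I$. **Cumulative polynomials.** For $n\ge1$ and $t=1,2,3$ let $$x_t(n)=\sum f_{i_n\dots i_2t},\qquad y_t(n)=\sum e_{i_n\dots i_2t},\qquad x_0(n)=\sum g_{i_n\dots i_20},$$ where the first two sums run over the admissible sequences of length $n$ that start at $t$, and the third over all admissible sequences $i_n\dots i_2$ of length $n-1$ (so $x_0(1)=g_0=I$). **Proposition.** Let $\rho$ be a representation of $D^{2,2,2}$, let $n\ge1$, and let $z_t(n)$ be one of the cumulative polynomials $x_t(n)$, $y_t(n)$ ($t=1,2,3$) or $x_0(n)$. Then $$\sum_{i=1,2,3}\varphi_i\bigl(\Phi^+\rho(z_t(n))\bigr)=\rho(z_t(n+1)).$$ -/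

import Mathlib

/-! Indices `1, 2, 3` of the generators are represented by the elements `0, 1, 2` of `Fin 3`.
Sum and intersection in a lattice are `⊔` and `⊓`, the unity `I` is `⊤`. -/

namespace D222

/-! ### The modular lattice `D^{2,2,2}` -/

/-- Lattice polynomials in `x₁, x₂, x₃, y₁, y₂, y₃` and the unity. -/
inductive Term : Type
  | x : Fin 3 → Term
  | y : Fin 3 → Term
  | top : Term
  | sup : Term → Term → Term
  | inf : Term → Term → Term

/-- The smallest preorder on lattice polynomials that makes the quotient a modular lattice with
unity in which `xᵢ ≤ yᵢ`. -/
inductive Le : Term → Term → Prop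
  | refl (a : Term) : Le a a
  | trans {a b c : Term} : Le a b → Le b c → Le a c
  | gen (i : Fin 3) : Le (Term.x i) (Term.y i)
  | top (a : Term) : Le a Term.top
  | sup_left (a b : Term) : Le a (Term.sup a b)
  | sup_right (a b : Term) : Le b (Term.sup a b)
  | sup_le {a b c : Term} : Le a c → Le b c → Le (Term.sup a b) c
  | inf_left (a b : Term) : Le (Term.inf a b) a
  | inf_right (a b : Term) : Le (Term.inf a b) b
  | le_inf {a b c : Term} : Le a b → Le a c → Le a (Term.inf b c)
  | modular {a b : Term} (c : Term) : Le a b →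
      Le (Term.inf (Term.sup a c) b) (Term.sup a (Term.inf c b))

instance termSetoid : Setoid Term where
  r a b := Le a b ∧ Le b a
  iseqv :=
    { refl := fun a => ⟨Le.refl a, Le.refl a⟩
      symm := fun h => ⟨h.2, h.1⟩
      trans := fun h k => ⟨h.1.trans k.1, k.2.trans h.2⟩ }

end D222

/-- The modular lattice `D^{2,2,2}` with unity, generated by `xᵢ ≤ yᵢ` (`i = 1, 2, 3`) and subject
to no other relations. -/
def D222 : Type := Quotient D222.termSetoid

namespace D222

instance : LE D222 where
  le := Quotient.lift₂ Le (fun _ _ _ _ h k =>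
    propext ⟨fun l => (h.2.trans l).trans k.1, fun l => (h.1.trans l).trans k.2⟩)

instance : Lattice D222 where
  le_refl := by rintro ⟨a⟩; exact Le.refl a
  le_trans := by rintro ⟨a⟩ ⟨b⟩ ⟨c⟩ h k; exact Le.trans h k
  le_antisymm := by rintro ⟨a⟩ ⟨b⟩ h k; exact Quotient.sound ⟨h, k⟩
  sup := Quotient.map₂ Term.sup (fun _ _ h _ _ k =>
    ⟨Le.sup_le (h.1.trans (Le.sup_left _ _)) (k.1.trans (Le.sup_right _ _)),
     Le.sup_le (h.2.trans (Le.sup_left _ _)) (k.2.trans (Le.sup_right _ _))⟩)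
  le_sup_left := by rintro ⟨a⟩ ⟨b⟩; exact Le.sup_left a b
  le_sup_right := by rintro ⟨a⟩ ⟨b⟩; exact Le.sup_right a b
  sup_le := by rintro ⟨a⟩ ⟨b⟩ ⟨c⟩ h k; exact Le.sup_le h k
  inf := Quotient.map₂ Term.inf (fun _ _ h _ _ k =>
    ⟨Le.le_inf ((Le.inf_left _ _).trans h.1) ((Le.inf_right _ _).trans k.1),
     Le.le_inf ((Le.inf_left _ _).trans h.2) ((Le.inf_right _ _).trans k.2)⟩)
  inf_le_left := by rintro ⟨a⟩ ⟨b⟩; exact Le.inf_left a b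
  inf_le_right := by rintro ⟨a⟩ ⟨b⟩; exact Le.inf_right a b
  le_inf := by rintro ⟨a⟩ ⟨b⟩ ⟨c⟩ h k; exact Le.le_inf h k

instance : OrderTop D222 where
  top := Quotient.mk _ Term.top
  le_top := by rintro ⟨a⟩; exact Le.top a

instance : IsModularLattice D222 where
  sup_inf_le_assoc_of_le := by rintro ⟨a⟩ ⟨b⟩ ⟨c⟩ h; exact Le.modular b h

/-- The generator `xᵢ`. -/
def x (i : Fin 3) : D222 := Quotient.mk _ (Term.x i)

/-- The generator `yᵢ`. -/
def y (i : Fin 3) : D222 := Quotient.mk _ (Term.y i)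

theorem x_le_y (i : Fin 3) : x i ≤ y i := Le.gen i

section lift

variable {L : Type*} [Lattice L] [OrderTop L]

/-- The value of a lattice polynomial at given elements of a lattice. -/
def Term.eval (X Y : Fin 3 → L) : Term → L
  | Term.x i => X i
  | Term.y i => Y i
  | Term.top => ⊤
  | Term.sup a b => a.eval X Y ⊔ b.eval X Y
  | Term.inf a b => a.eval X Y ⊓ b.eval X Y

theorem Le.eval_le [IsModularLattice L] {X Y : Fin 3 → L} (h : ∀ i, X i ≤ Y i) {a b : Term}
    (l : Le a b) : a.eval X Y ≤ b.eval X Y := by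
  induction l with
  | refl a => exact le_rfl
  | trans _ _ h1 h2 => exact h1.trans h2
  | gen i => exact h i
  | top a => exact le_top
  | sup_left a b => exact le_sup_left
  | sup_right a b => exact le_sup_right
  | sup_le _ _ h1 h2 => exact _root_.sup_le h1 h2
  | inf_left a b => exact inf_le_left
  | inf_right a b => exact inf_le_right
  | le_inf _ _ h1 h2 => exact _root_.le_inf h1 h2
  | modular c _ h1 => exact IsModularLattice.sup_inf_le_assoc_of_le _ h1

/-- The lattice morphism from `D^{2,2,2}` to a modular lattice with prescribed images
`X i ≤ Y i` of the generators `xᵢ ≤ yᵢ`, preserving the unity. -/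
def lift [IsModularLattice L] (X Y : Fin 3 → L) (h : ∀ i, X i ≤ Y i) : LatticeHom D222 L where
  toFun := Quotient.lift (Term.eval X Y)
    (fun _ _ k => le_antisymm (k.1.eval_le h) (k.2.eval_le h))
  map_sup' := by rintro ⟨a⟩ ⟨b⟩; rfl
  map_inf' := by rintro ⟨a⟩ ⟨b⟩; rfl

end lift

/-! ### Linear representations, the Coxeter functor and the elementary maps -/

/-- A linear representation of `D^{2,2,2}` in the space `V`: a lattice morphism to the lattice of
linear subspaces of `V` sending the unity to `V`. -/
structure Representation (K V : Type*) [Field K] [AddCommGroup V] [Module K V] where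
  toHom : LatticeHom D222 (Submodule K V)
  map_top : toHom ⊤ = ⊤

namespace Representation

variable {K V : Type*} [Field K] [AddCommGroup V] [Module K V] (ρ : Representation K V)

instance : CoeFun (Representation K V) (fun _ => D222 → Submodule K V) where
  coe ρ := ρ.toHom

/-- The space `X₀¹ = {(η₁, η₂, η₃) | ηᵢ ∈ Yᵢ, η₁ + η₂ + η₃ = 0}`, where `Yᵢ = ρ(yᵢ)`. -/
def coxeterSpace : Submodule K (Fin 3 → V) where
  carrier := {η | (∀ i, η i ∈ ρ (y i)) ∧ ∑ i, η i = 0}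
  add_mem' := by
    rintro a b ⟨ha, ha'⟩ ⟨hb, hb'⟩
    exact ⟨fun i => add_mem (ha i) (hb i), by simp [Finset.sum_add_distrib, ha', hb']⟩
  zero_mem' := ⟨fun i => zero_mem _, by simp⟩
  smul_mem' := by
    rintro c a ⟨ha, ha'⟩
    exact ⟨fun i => Submodule.smul_mem _ c (ha i), by simp [← Finset.smul_sum, ha']⟩

/-- The elementary linear map `φᵢ : X₀¹ → X₀`, `(η₁, η₂, η₃) ↦ ηᵢ`. -/
def phi (i : Fin 3) : ρ.coxeterSpace →ₗ[K] V :=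
  (LinearMap.proj i).comp ρ.coxeterSpace.subtype

/-- The representation `Φ⁺ρ` in the space `X₀¹`, with
`Φ⁺ρ(xᵢ) = Xᵢ¹ = {η ∈ X₀¹ | ηᵢ = 0}` and `Φ⁺ρ(yᵢ) = Yᵢ¹ = {η ∈ X₀¹ | ηᵢ ∈ Xᵢ}`, where
`Xᵢ = ρ(xᵢ)`. -/
def coxeter : Representation K ρ.coxeterSpace where
  toHom := lift (fun i => Submodule.comap (ρ.phi i) ⊥) (fun i => Submodule.comap (ρ.phi i) (ρ (x i)))
    (fun _ => Submodule.comap_mono bot_le)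
  map_top := rfl

end Representation

/-! ### Atomic elements -/

/-- The index `k` with `{i, j, k} = {1, 2, 3}`, for `i ≠ j`. -/
def third (i j : Fin 3) : Fin 3 := -(i + j)

/-- The atomic elements: `a n i j` is `a_n^{ij}`, with `a_0^{ij} = I` and
`a_n^{ij} = x_i + y_j a_{n-1}^{jk}`. -/
def a : ℕ → Fin 3 → Fin 3 → D222
  | 0, _, _ => ⊤
  | n + 1, i, j => x i ⊔ y j ⊓ a n j (third i j)

/-- The atomic elements: `A n i j` is `A_n^{ij}`, with `A_0^{ij} = I` and
`A_n^{ij} = y_i + x_j A_{n-1}^{ki}`. -/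
def A : ℕ → Fin 3 → Fin 3 → D222
  | 0, _, _ => ⊤
  | n + 1, i, j => y i ⊔ x j ⊓ A n (third i j) i

/-! ### Admissible sequences

A sequence `i_n … i_2 i_1` is the list `[i_n, …, i_2, i_1]`: it starts at its last entry `i_1`. -/

/-- Adjacent indices are distinct. -/
def IsAdmissible (α : List (Fin 3)) : Prop := α.IsChain (· ≠ ·)

/-- Replacing a subsequence `iji` by `iki`, where `i, j, k` are distinct. -/
inductive Replace : List (Fin 3) → List (Fin 3) → Prop
  | mk (l r : List (Fin 3)) (i j k : Fin 3) (hij : i ≠ j) (hik : i ≠ k) (hjk : j ≠ k) :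
      Replace (l ++ i :: j :: i :: r) (l ++ i :: k :: i :: r)

/-- Two sequences are identified if they are connected by replacements `iji = iki`. -/
def SeqEquiv : List (Fin 3) → List (Fin 3) → Prop := Relation.EqvGen Replace

/-- `power s m` is the sequence `s^m`. -/
def power (s : List (Fin 3)) (m : ℕ) : List (Fin 3) := (List.replicate m s).flatten

/-! ### Admissible elements -/

/-- An admissible sequence `α` together with the elements `f_α`, `e_α`, `g_{α0}`. -/
structure AdmissibleData where
  α : List (Fin 3)
  f : D222
  e : D222
  g : D222

/-- Auxiliary constructor: `g_{α0}` is always of the form `e_α · h`. -/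
def AdmissibleData.of (α : List (Fin 3)) (f e h : D222) : AdmissibleData := ⟨α, f, e, e ⊓ h⟩

/-- The table of the admissible elements, in normal form, whose sequence starts at `u`. The
indices `u, v, w` are a permutation of `1, 2, 3` (for `u, v, w = 1, 2, 3` the sequences are built
from `213` and `21`; the others are obtained by permuting indices). The columns are `α`, `f_α`,
`e_α`, `h` with `g_{α0} = e_α h`. -/
def table (u v w : Fin 3) (k p : ℕ) : Fin 14 → AdmissibleData :=
  let q := k + 3 * p
  let γ := power [v, u, w] (2 * p) ++ power [v, u] (2 * k)
  let β := power [v, u, w] (2 * p) ++ power [v, u] (2 * k + 1)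
  ![.of γ
      (y u ⊓ y v ⊓ a q u w ⊓ A (k - 1) w v)
      (y v ⊓ A (k - 1) w v ⊓ a q v u ⊓ A k u w ⊓ a q u w)
      (x u ⊔ a q w v ⊓ A k w v),
    .of ([w] ++ γ)
      (y w ⊓ (x u ⊔ x v) ⊓ A q v w ⊓ a (k - 1) w u)
      (y w ⊓ a (k - 1) w u ⊓ A (q + 1) u v ⊓ a k u v ⊓ A q v w)
      (y v ⊓ y w ⊔ A q u v ⊓ a k w u),
    .of ([u, w] ++ γ)
      (y w ⊓ y u ⊓ a (q + 1) w v ⊓ A (k - 1) v u)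
      (y u ⊓ A (k - 1) v u ⊓ a (q + 1) u w ⊓ A k w v ⊓ a (q + 1) w v)
      (x w ⊔ a (q + 1) v u ⊓ A k v u),
    .of ([v, u, w] ++ γ)
      (y v ⊓ (x w ⊔ x u) ⊓ A (q + 1) u v ⊓ a (k - 1) v w)
      (y v ⊓ a (k - 1) v w ⊓ A (q + 2) w u ⊓ a k w u ⊓ A (q + 1) u v)
      (y u ⊓ y v ⊔ A (q + 1) w u ⊓ a k v w),
    .of ([w, v, u, w] ++ γ)
      (y v ⊓ y w ⊓ a (q + 2) v u ⊓ A (k - 1) u w)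
      (y w ⊓ A (k - 1) u w ⊓ a (q + 2) w v ⊓ A k v u ⊓ a (q + 2) v u)
      (x v ⊔ a (q + 2) u w ⊓ A k u w),
    .of ([u, w, v, u, w] ++ γ)
      (y u ⊓ (x v ⊔ x w) ⊓ A (q + 2) w u ⊓ a (k - 1) u v)
      (y u ⊓ a (k - 1) u v ⊓ A (q + 3) v w ⊓ a k v w ⊓ A (q + 2) w u)
      (y u ⊓ y w ⊔ A (q + 2) v w ⊓ a k u v),
    .of ([u] ++ power [v, u] (2 * k))
      (x u ⊓ A k v w ⊓ a k v w)
      (y u ⊓ A k w u ⊓ a k u v ⊓ A k v w ⊓ a k v w)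
      (y v ⊓ a k v u ⊔ y w ⊓ a k w u),
    .of ([u] ++ power [v, u] (2 * k + 1))
      (y u ⊓ (x v ⊔ x w) ⊓ A k w u ⊓ a k u v)
      (y u ⊓ A k w u ⊓ a k u v ⊓ A (k + 1) v w ⊓ a (k + 1) v w)
      (y u ⊓ a (k + 1) u v ⊔ y u ⊓ a (k + 1) u w),
    .of β
      (y v ⊓ y w ⊓ a q v u ⊓ A k u w)
      (y v ⊓ A k w v ⊓ a q v u ⊓ A k u w ⊓ a (q + 1) u w)
      (x v ⊔ a q u w ⊓ A (k + 1) u w),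
    .of ([w] ++ β)
      (x w ⊓ A (q + 1) u v ⊓ a k u v)
      (y w ⊓ a k w u ⊓ A (q + 1) u v ⊓ a k u v ⊓ A (q + 1) v w)
      (y u ⊓ y w ⊔ A q v w ⊓ a (k + 1) u v),
    .of ([u, w] ++ β)
      (y u ⊓ y v ⊓ a (q + 1) u w ⊓ A k w v)
      (y u ⊓ A k v u ⊓ a (q + 1) u w ⊓ A k w v ⊓ a (q + 2) w v)
      (x u ⊔ a (q + 1) w v ⊓ A (k + 1) w v),
    .of ([v, u, w] ++ β)
      (x v ⊓ A (q + 2) w u ⊓ a k w u)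
      (y v ⊓ a k v w ⊓ A (q + 2) w u ⊓ a k w u ⊓ A (q + 2) u v)
      (y v ⊓ y w ⊔ A (q + 1) u v ⊓ a (k + 1) w u),
    .of ([w, v, u, w] ++ β)
      (y w ⊓ y u ⊓ a (q + 2) w v ⊓ A k v u)
      (y w ⊓ A k u w ⊓ a (q + 2) w v ⊓ A k v u ⊓ a (q + 3) v u)
      (x w ⊔ a (q + 2) v u ⊓ A (k + 1) v u),
    .of ([u, w, v, u, w] ++ β)
      (x u ⊓ A (q + 3) v w ⊓ a k v w)
      (y u ⊓ a k u v ⊓ A (q + 3) v w ⊓ a k v w ⊓ A (q + 3) w u)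
      (y u ⊓ y v ⊔ A (q + 2) w u ⊓ a (k + 1) v w)]

/-- `TableEntry d`: `d` is one of the entries of the table. In the first six lines `k > 0`;
lines seven and eight do not involve `p`. -/
def TableEntry (d : AdmissibleData) : Prop :=
  ∃ (σ : Equiv.Perm (Fin 3)) (k p : ℕ) (N : Fin 14),
    ((N : ℕ) < 6 → 0 < k) ∧ ((N : ℕ) = 6 ∨ (N : ℕ) = 7 → p = 0) ∧
    d = table (σ 0) (σ 1) (σ 2) k p N

/-- `AdmissibleElements α f e g`: the sequence `α` is admissible and `f = f_α`, `e = e_α`,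
`g = g_{α0}`, read off from the table after bringing `α` to normal form. -/
def AdmissibleElements (α : List (Fin 3)) (f e g : D222) : Prop :=
  IsAdmissible α ∧ ∃ d, TableEntry d ∧ SeqEquiv α d.α ∧ f = d.f ∧ e = d.e ∧ g = d.g

/-! ### Cumulative polynomials -/

/-- The elements `f_{i_n … i_2 t}`. -/
def fSet (t : Fin 3) (n : ℕ) : Set D222 :=
  {f | ∃ α e g, AdmissibleElements α f e g ∧ α.length = n ∧ α.getLast? = some t}

/-- The elements `e_{i_n … i_2 t}`. -/
def eSet (t : Fin 3) (n : ℕ) : Set D222 :=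
  {e | ∃ α f g, AdmissibleElements α f e g ∧ α.length = n ∧ α.getLast? = some t}

/-- The elements `g_{i_n … i_2 0}`; for `n = 1` this is only `g_0 = I`. -/
def gSet (n : ℕ) : Set D222 :=
  {g | (n = 1 ∧ g = ⊤) ∨ ∃ α f e, AdmissibleElements α f e g ∧ α.length + 1 = n}

theorem SeqEquiv.length_eq {α β : List (Fin 3)} (h : SeqEquiv α β) : α.length = β.length := by
  induction h with
  | rel _ _ h => cases h; simp
  | refl => rfl
  | symm _ _ _ h => exact h.symm
  | trans _ _ _ _ _ h k => exact h.trans k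

theorem length_power (s : List (Fin 3)) (m : ℕ) : (power s m).length = m * s.length := by
  simp [power]

theorem exists_table_α (u v w : Fin 3) (k p : ℕ) (N : Fin 14)
    (hp : (N : ℕ) = 6 ∨ (N : ℕ) = 7 → p = 0) :
    ∃ l r q, p ≤ q ∧ k ≤ r ∧
      (table u v w k p N).α = l ++ (power [v, u, w] q ++ power [v, u] r) := by
  match N, hp with
  | 0, _ => exact ⟨[], 2 * k, 2 * p, by omega, by omega, rfl⟩
  | 1, _ => exact ⟨[w], 2 * k, 2 * p, by omega, by omega, rfl⟩
  | 2, _ => exact ⟨[u, w], 2 * k, 2 * p, by omega, by omega, rfl⟩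
  | 3, _ => exact ⟨[v, u, w], 2 * k, 2 * p, by omega, by omega, rfl⟩
  | 4, _ => exact ⟨[w, v, u, w], 2 * k, 2 * p, by omega, by omega, rfl⟩
  | 5, _ => exact ⟨[u, w, v, u, w], 2 * k, 2 * p, by omega, by omega, rfl⟩
  | 6, h => exact ⟨[u], 2 * k, 0, (h (Or.inl rfl)).le, by omega, rfl⟩
  | 7, h => exact ⟨[u], 2 * k + 1, 0, (h (Or.inr rfl)).le, by omega, rfl⟩
  | 8, _ => exact ⟨[], 2 * k + 1, 2 * p, by omega, by omega, rfl⟩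
  | 9, _ => exact ⟨[w], 2 * k + 1, 2 * p, by omega, by omega, rfl⟩
  | 10, _ => exact ⟨[u, w], 2 * k + 1, 2 * p, by omega, by omega, rfl⟩
  | 11, _ => exact ⟨[v, u, w], 2 * k + 1, 2 * p, by omega, by omega, rfl⟩
  | 12, _ => exact ⟨[w, v, u, w], 2 * k + 1, 2 * p, by omega, by omega, rfl⟩
  | 13, _ => exact ⟨[u, w, v, u, w], 2 * k + 1, 2 * p, by omega, by omega, rfl⟩

theorem finite_tableEntry (n : ℕ) : {d | TableEntry d ∧ d.α.length = n}.Finite := by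
  have h : (Set.range fun z : Equiv.Perm (Fin 3) × Fin (n + 1) × Fin (n + 1) × Fin 14 =>
      table (z.1 0) (z.1 1) (z.1 2) z.2.1 z.2.2.1 z.2.2.2).Finite := Set.finite_range _
  refine h.subset ?_
  rintro d ⟨⟨σ, k, p, N, -, hp, rfl⟩, hn⟩
  obtain ⟨l, r, q, hq, hr, hα⟩ := exists_table_α (σ 0) (σ 1) (σ 2) k p N hp
  have hb : k < n + 1 ∧ p < n + 1 := by
    rw [hα] at hn
    simp only [List.length_append, length_power, List.length_cons, List.length_nil] at hn
    omega
  exact ⟨(σ, ⟨k, hb.1⟩, ⟨p, hb.2⟩, N), rfl⟩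

theorem finite_fSet (t : Fin 3) (n : ℕ) : (fSet t n).Finite := by
  refine ((finite_tableEntry n).image AdmissibleData.f).subset ?_
  rintro f ⟨α, e, g, ⟨-, d, hd, hα, hf, -, -⟩, hn, -⟩
  exact ⟨d, ⟨hd, hα.length_eq ▸ hn⟩, hf.symm⟩

theorem finite_eSet (t : Fin 3) (n : ℕ) : (eSet t n).Finite := by
  refine ((finite_tableEntry n).image AdmissibleData.e).subset ?_
  rintro e ⟨α, f, g, ⟨-, d, hd, hα, -, he, -⟩, hn, -⟩
  exact ⟨d, ⟨hd, hα.length_eq ▸ hn⟩, he.symm⟩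

theorem finite_gSet (n : ℕ) : (gSet n).Finite := by
  refine (((finite_tableEntry (n - 1)).image AdmissibleData.g).union
    (Set.finite_singleton ⊤)).subset ?_
  rintro g (⟨-, rfl⟩ | ⟨α, f, e, ⟨-, d, hd, hα, -, -, hg⟩, hn⟩)
  · exact Or.inr rfl
  · refine Or.inl ⟨d, ⟨hd, ?_⟩, hg.symm⟩
    rw [← hα.length_eq]; omega

theorem isChain_power {u v : Fin 3} (h : u ≠ v) (m : ℕ) :
    (u :: power [v, u] m).IsChain (· ≠ ·) := by
  induction m with
  | zero => simp [power]
  | succ m ih =>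
    have : u :: power [v, u] (m + 1) = u :: v :: u :: power [v, u] m := by
      simp [power, List.replicate_succ]
    rw [this]
    exact List.isChain_cons_cons.2 ⟨h, List.isChain_cons_cons.2 ⟨h.symm, ih⟩⟩

theorem getLast_power (u v : Fin 3) (m : ℕ) :
    (u :: power [v, u] m).getLast? = some u := by
  induction m with
  | zero => simp [power]
  | succ m ih =>
    have : u :: power [v, u] (m + 1) = u :: v :: (u :: power [v, u] m) := by
      simp [power, List.replicate_succ]
    rw [this, List.getLast?_cons_cons, List.getLast?_cons_cons, ih]

theorem exists_admissibleElements (t : Fin 3) {n : ℕ} (hn : 1 ≤ n) :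
    ∃ α f e g, AdmissibleElements α f e g ∧ α.length = n ∧ α.getLast? = some t := by
  obtain ⟨σ, rfl⟩ : ∃ σ : Equiv.Perm (Fin 3), σ 0 = t := ⟨Equiv.swap 0 t, by simp⟩
  have huv : σ 0 ≠ σ 1 := fun h => by simpa using σ.injective h
  suffices H : ∃ d, TableEntry d ∧ IsAdmissible d.α ∧ d.α.length = n ∧
      d.α.getLast? = some (σ 0) by
    obtain ⟨d, h1, h2, h3, h4⟩ := H
    exact ⟨d.α, d.f, d.e, d.g, ⟨h2, d, h1, Relation.EqvGen.refl _, rfl, rfl, rfl⟩, h3, h4⟩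
  have key : ∀ m, power [σ 1, σ 0] (m + 1) = σ 1 :: σ 0 :: power [σ 1, σ 0] m := fun m => by
    simp [power, List.replicate_succ]
  have hz : ∀ s, power s 0 = [] := fun s => rfl
  obtain ⟨k, hk⟩ : ∃ k, n = 4 * k + 1 ∨ n = 4 * k + 2 ∨ n = 4 * k + 3 ∨ n = 4 * k + 4 :=
    ⟨(n - 1) / 4, by omega⟩
  rcases hk with rfl | rfl | rfl | rfl
  · refine ⟨_, ⟨σ, k, 0, 6, by simp, by simp, rfl⟩, ?_⟩
    refine ⟨isChain_power huv (2 * k), ?_, getLast_power _ _ (2 * k)⟩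
    simp [table, AdmissibleData.of, length_power]; omega
  · refine ⟨_, ⟨σ, k, 0, 8, by simp, by simp, rfl⟩, ?_⟩
    have h : (table (σ 0) (σ 1) (σ 2) k 0 8).α = σ 1 :: σ 0 :: power [σ 1, σ 0] (2 * k) :=
      key (2 * k)
    rw [h, List.getLast?_cons_cons]
    refine ⟨List.isChain_cons_cons.2 ⟨huv.symm, isChain_power huv (2 * k)⟩, ?_,
      getLast_power _ _ (2 * k)⟩
    simp [length_power]; omega
  · refine ⟨_, ⟨σ, k, 0, 7, by simp, by simp, rfl⟩, ?_⟩
    refine ⟨isChain_power huv (2 * k + 1), ?_, getLast_power _ _ (2 * k + 1)⟩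
    simp [table, AdmissibleData.of, length_power]; omega
  · refine ⟨_, ⟨σ, k + 1, 0, 0, by simp, by simp, rfl⟩, ?_⟩
    have h : (table (σ 0) (σ 1) (σ 2) (k + 1) 0 0).α
        = σ 1 :: σ 0 :: power [σ 1, σ 0] (2 * k + 1) :=
      key (2 * k + 1)
    rw [h, List.getLast?_cons_cons]
    refine ⟨List.isChain_cons_cons.2 ⟨huv.symm, isChain_power huv (2 * k + 1)⟩, ?_,
      getLast_power _ _ (2 * k + 1)⟩
    simp [length_power]; omega

theorem nonempty_fSet (t : Fin 3) {n : ℕ} (hn : 1 ≤ n) : (fSet t n).Nonempty := by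
  obtain ⟨α, f, e, g, h⟩ := exists_admissibleElements t hn
  exact ⟨f, α, e, g, h⟩

theorem nonempty_eSet (t : Fin 3) {n : ℕ} (hn : 1 ≤ n) : (eSet t n).Nonempty := by
  obtain ⟨α, f, e, g, h⟩ := exists_admissibleElements t hn
  exact ⟨e, α, f, g, h⟩

theorem nonempty_gSet {n : ℕ} (hn : 1 ≤ n) : (gSet n).Nonempty := by
  rcases Nat.lt_or_ge 1 n with h1 | h1
  · obtain ⟨α, f, e, g, h, hl, -⟩ := exists_admissibleElements 0 (n := n - 1) (by omega)
    exact ⟨g, Or.inr ⟨α, f, e, h, by omega⟩⟩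
  · exact ⟨⊤, Or.inl ⟨by omega, rfl⟩⟩

/-- The sum (join) of a finite non-empty set of elements. -/
noncomputable def sum (S : Set D222) (hS : S.Finite) (hne : S.Nonempty) : D222 :=
  hS.toFinset.sup' (hS.toFinset_nonempty.2 hne) id

/-- The cumulative polynomial `x_t(n) = ∑ f_{i_n … i_2 t}`, for `n ≥ 1`. -/
noncomputable def cumX (t : Fin 3) (n : ℕ) (hn : 1 ≤ n) : D222 :=
  sum (fSet t n) (finite_fSet t n) (nonempty_fSet t hn)

/-- The cumulative polynomial `y_t(n) = ∑ e_{i_n … i_2 t}`, for `n ≥ 1`. -/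
noncomputable def cumY (t : Fin 3) (n : ℕ) (hn : 1 ≤ n) : D222 :=
  sum (eSet t n) (finite_eSet t n) (nonempty_eSet t hn)

/-- The cumulative polynomial `x_0(n) = ∑ g_{i_n … i_2 0}`, for `n ≥ 1`. -/
noncomputable def cumX0 (n : ℕ) (hn : 1 ≤ n) : D222 :=
  sum (gSet n) (finite_gSet n) (nonempty_gSet hn)

end D222

/-!
If `φᵢ` carries `Φ⁺ρ(z_α)` onto `ρ(z_{iα})`, then the images of `Φ⁺ρ(z_α)` under two of the three
maps account for two continuations of `α`. Since `φ₁ + φ₂ + φ₃ = 0`, the third image lies in the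
sum of these two, so the sum of all images over the sequences of length `n` is the sum over the
sequences of length `n + 1`.

The subspaces `Φ⁺ρ(a_n)` and `Φ⁺ρ(A_n)` of atomic elements are preimages of subspaces of `X₀` under
one of the `φᵢ`. A subspace of `X₀¹` cut out by such conditions, one for each coordinate, has images
that are computed by the modular law. The remaining transitions between the rows of the table come
from `φᵢφⱼφᵢ = -φᵢφₖφᵢ`, the counterpart of the identification `iji = iki`; it holds because
`φᵢφᵢφᵢ = 0`.
-/

universe v

namespace D222

/-- `i, j, k` are the indices `1, 2, 3` in some order. -/
def IsTriple (i j k : Fin 3) : Prop := i ≠ j ∧ i ≠ k ∧ j ≠ k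

namespace IsTriple

variable {i j k : Fin 3}

theorem rotate_right (h : IsTriple i j k) : IsTriple k i j :=
  ⟨h.2.1.symm, h.2.2.symm, h.1⟩

theorem rotate_left (h : IsTriple i j k) : IsTriple j k i := h.rotate_right.rotate_right

theorem swap_right (h : IsTriple i j k) : IsTriple i k j := ⟨h.2.1, h.1, h.2.2.symm⟩

theorem swap_left (h : IsTriple i j k) : IsTriple j i k := h.swap_right.rotate_right

theorem reverse (h : IsTriple i j k) : IsTriple k j i := h.rotate_right.swap_right

theorem third_eq (h : IsTriple i j k) : third i j = k := by
  revert i j k; unfold IsTriple; decide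

theorem univ_eq (h : IsTriple i j k) : (Finset.univ : Finset (Fin 3)) = {i, j, k} := by
  revert i j k; unfold IsTriple; decide

theorem eq_or (h : IsTriple i j k) (l : Fin 3) : l = i ∨ l = j ∨ l = k := by
  simpa [h.univ_eq] using Finset.mem_univ l

theorem sum_eq {M : Type*} [AddCommMonoid M] (h : IsTriple i j k) (f : Fin 3 → M) :
    ∑ l, f l = f i + f j + f k := by
  rw [h.univ_eq, Finset.sum_insert (by simp [h.1, h.2.1]), Finset.sum_pair h.2.2, add_assoc]

end IsTriple

section ModularIdentities

variable {L : Type*} [Lattice L] [IsModularLattice L]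

theorem inf_sup_inf_self (b c d : L) : b ⊓ (c ⊔ b ⊓ d) = b ⊓ c ⊔ b ⊓ d := by
  rw [sup_comm, inf_comm, sup_inf_assoc_of_le c inf_le_left, sup_comm, inf_comm c]

theorem inf_sup_inf_comm (b c d : L) : b ⊓ (c ⊔ b ⊓ d) = b ⊓ (c ⊓ b ⊔ d) := by
  rw [inf_sup_inf_self, inf_comm c, sup_comm _ d, inf_sup_inf_self, sup_comm]

theorem inf_sup_inf_sup {p r b c : L} (h : p ≤ c) :
    b ⊓ (c ⊔ r ⊓ (b ⊔ p)) = b ⊓ (c ⊓ b ⊔ (p ⊔ r)) := by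
  have exchange : p ⊔ r ⊓ (b ⊔ p) = p ⊔ b ⊓ (p ⊔ r) := by
    rw [← sup_inf_assoc_of_le _ le_sup_right, ← sup_inf_assoc_of_le _ le_sup_left, inf_comm,
      sup_comm b]
  rw [← inf_sup_inf_comm, ← sup_eq_left.2 h, sup_assoc, exchange, sup_assoc]

theorem inf_sup_inf_sup_inf {b c d m p : L} (hm : m ≤ b) (hp : p ≤ c) :
    d ⊓ (m ⊔ p ⊓ (b ⊓ c ⊔ d)) = d ⊓ (m ⊔ p) ⊓ (b ⊓ d ⊔ c) := by
  have restrict : p ⊓ (b ⊓ c ⊔ d) = p ⊓ (b ⊔ d ⊓ c) := by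
    rw [← inf_eq_left.2 hp, inf_assoc, inf_assoc, ← inf_sup_inf_comm, inf_comm c d]
  rw [restrict, ← sup_inf_assoc_of_le _ (hm.trans le_sup_left), inf_left_comm, inf_sup_inf_comm,
    inf_left_comm, inf_assoc]

end ModularIdentities

section AtomicElements

theorem y_inf_x (i : Fin 3) : y i ⊓ x i = x i := inf_eq_right.2 (x_le_y i)

theorem y_inf_x_inf (i : Fin 3) (b : D222) : y i ⊓ (x i ⊓ b) = x i ⊓ b := by
  rw [← inf_assoc, y_inf_x]

theorem a_zero (i j : Fin 3) : a 0 i j = ⊤ := rfl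

theorem A_zero (i j : Fin 3) : A 0 i j = ⊤ := rfl

theorem x_le_a (n : ℕ) (i j : Fin 3) : x i ≤ a n i j := by
  cases n
  · exact le_top
  · exact le_sup_left

theorem y_le_A (n : ℕ) (i j : Fin 3) : y i ≤ A n i j := by
  cases n
  · exact le_top
  · exact le_sup_left

theorem x_le_A (n : ℕ) (i j : Fin 3) : x i ≤ A n i j := (x_le_y i).trans (y_le_A n i j)

theorem x_le_a_right (n : ℕ) (i j : Fin 3) : x j ≤ a n i j := by
  cases n
  · exact le_top
  · exact (le_inf (x_le_y j) (x_le_a _ _ _)).trans le_sup_right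

theorem a_succ_le (n : ℕ) (i j : Fin 3) : a (n + 1) i j ≤ a n i j := by
  induction n generalizing i j with
  | zero => exact le_top
  | succ n ih => exact sup_le_sup_left (inf_le_inf_left _ (ih _ _)) _

theorem A_succ_le (n : ℕ) (i j : Fin 3) : A (n + 1) i j ≤ A n i j := by
  induction n generalizing i j with
  | zero => exact le_top
  | succ n ih => exact sup_le_sup_left (inf_le_inf_left _ (ih _ _)) _

variable {i j k : Fin 3}

theorem a_succ (h : IsTriple i j k) (n : ℕ) : a (n + 1) i j = x i ⊔ y j ⊓ a n j k := by
  rw [a, h.third_eq]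

theorem A_succ (h : IsTriple i j k) (n : ℕ) : A (n + 1) i j = y i ⊔ x j ⊓ A n k i := by
  rw [A, h.third_eq]

theorem y_inf_a_le_a_succ (h : IsTriple i j k) (n : ℕ) : y j ⊓ a n j k ≤ a (n + 1) i j :=
  (a_succ h n).symm ▸ le_sup_right

theorem x_inf_sup_y_inf_a (h : IsTriple i j k) (n : ℕ) {b : D222} (hb : y j ≤ b) :
    x i ⊓ b ⊔ y j ⊓ a n j k = b ⊓ a (n + 1) i j := by
  rw [a_succ h, inf_comm b, sup_comm, sup_comm (x i), sup_inf_assoc_of_le]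
  exact inf_le_left.trans hb

theorem x_inf_A_sup_y_inf (h : IsTriple i j k) (n : ℕ) {b : D222} (hb : x j ≤ b) :
    x j ⊓ A n k i ⊔ y i ⊓ b = A (n + 1) i j ⊓ b := by
  rw [A_succ h, sup_comm (y i), sup_inf_assoc_of_le]
  exact inf_le_left.trans hb

theorem y_inf_y_inf_a_le_A (h : IsTriple i j k) (n : ℕ) : y i ⊓ y j ⊓ a n i k ≤ A n k i := by
  induction n generalizing i j k with
  | zero => exact le_top
  | succ n ih =>
    have h_split : y i ⊓ y j ⊓ a (n + 1) i k ≤ A n j k ⊓ (x i ⊔ y k ⊓ y i ⊓ a n k j) := by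
      refine le_inf (inf_le_left.trans (inf_le_right.trans (y_le_A _ _ _))) ?_
      rw [a_succ h.swap_right, inf_right_comm (y k), ← sup_inf_assoc_of_le _ (x_le_y i), inf_comm]
      exact inf_le_inf_left _ inf_le_left
    refine h_split.trans ?_
    rw [A_succ h.rotate_right, inf_comm, sup_comm, sup_inf_assoc_of_le _ (ih h.rotate_right)]
    exact sup_le_sup (inf_le_left.trans inf_le_left) le_rfl

theorem y_inf_y_inf_a_inf_A_le_a (h : IsTriple i j k) (n : ℕ) :
    y j ⊓ y k ⊓ a n k i ⊓ A (n + 1) i j ≤ a (n + 1) j i := by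
  induction n generalizing i j k with
  | zero =>
    refine inf_le_right.trans ?_
    rw [A_succ h, a_succ h.swap_left, a_zero, A_zero, inf_top_eq, inf_top_eq, sup_comm]
  | succ n ih =>
    have h_left : y j ⊓ y k ⊓ a (n + 1) k i ≤ y j ⊓ a n j k ⊓ A (n + 1) k i := by
      refine le_inf (le_inf (inf_le_left.trans inf_le_left) ?_)
        (inf_le_left.trans (inf_le_right.trans (y_le_A _ _ _)))
      exact (inf_le_inf_right _ inf_le_right).trans
        ((y_inf_a_le_a_succ h.rotate_left (n + 1)).trans
          ((a_succ_le _ _ _).trans (a_succ_le _ _ _)))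
    have h_right : x j ⊓ A (n + 1) k i ≤ y j ⊓ a n j k ⊓ A (n + 1) k i :=
      inf_le_inf_right _ (le_inf (x_le_y j) (x_le_a _ _ _))
    refine (inf_le_inf_right _ h_left).trans ?_
    rw [A_succ h (n + 1), inf_comm, sup_comm, sup_inf_assoc_of_le _ h_right,
      a_succ h.swap_left (n + 1)]
    refine sup_le_sup inf_le_left (le_inf inf_le_left ?_)
    rw [← inf_assoc, ← inf_assoc]
    exact ih h.rotate_right

end AtomicElements

namespace Representation

variable {K V : Type*} [Field K] [AddCommGroup V] [Module K V] (ρ : Representation K V)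
  {i j k : Fin 3}

theorem apply_sup (b c : D222) : ρ (b ⊔ c) = ρ b ⊔ ρ c := map_sup ρ.toHom b c

theorem apply_inf (b c : D222) : ρ (b ⊓ c) = ρ b ⊓ ρ c := map_inf ρ.toHom b c

theorem apply_mono {b c : D222} (h : b ≤ c) : ρ b ≤ ρ c := OrderHomClass.mono ρ.toHom h

theorem coxeter_sup (b c : D222) : ρ.coxeter (b ⊔ c) = ρ.coxeter b ⊔ ρ.coxeter c :=
  ρ.coxeter.apply_sup b c

theorem coxeter_inf (b c : D222) : ρ.coxeter (b ⊓ c) = ρ.coxeter b ⊓ ρ.coxeter c :=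
  ρ.coxeter.apply_inf b c

theorem coxeter_x (i : Fin 3) : ρ.coxeter (x i) = Submodule.comap (ρ.phi i) ⊥ := rfl

theorem coxeter_y (i : Fin 3) : ρ.coxeter (y i) = Submodule.comap (ρ.phi i) (ρ (x i)) := rfl

theorem phi_mem (i : Fin 3) (η : ρ.coxeterSpace) : ρ.phi i η ∈ ρ (y i) := η.2.1 i

theorem phi_add (h : IsTriple i j k) : ρ.phi i + ρ.phi j + ρ.phi k = 0 := by
  ext η
  rw [← h.sum_eq ρ.phi, LinearMap.sum_apply]
  exact η.2.2

theorem phi_eq_neg_add (h : IsTriple i j k) : ρ.phi i = -(ρ.phi j + ρ.phi k) := by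
  rw [eq_neg_iff_add_eq_zero, ← add_assoc, ρ.phi_add h]

theorem exists_phi_eq (h : IsTriple i j k) {b c d : V} (hb : b ∈ ρ (y i)) (hc : c ∈ ρ (y j))
    (hd : d ∈ ρ (y k)) (hs : b + c + d = 0) :
    ∃ η : ρ.coxeterSpace, ρ.phi i η = b ∧ ρ.phi j η = c ∧ ρ.phi k η = d := by
  let f : Fin 3 → V := fun l => if l = i then b else if l = j then c else d
  have fi : f i = b := by simp [f]
  have fj : f j = c := by simp [f, h.1.symm]
  have fk : f k = d := by simp [f, h.2.1.symm, h.2.2.symm]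
  refine ⟨⟨f, fun l => ?_, ?_⟩, fi, fj, fk⟩
  · rcases h.eq_or l with rfl | rfl | rfl
    · rwa [fi]
    · rwa [fj]
    · rwa [fk]
  · rw [h.sum_eq, fi, fj, fk, hs]

theorem map_phi_le_sup (h : IsTriple i j k) (S : Submodule K ρ.coxeterSpace) :
    S.map (ρ.phi i) ≤ S.map (ρ.phi j) ⊔ S.map (ρ.phi k) := by
  rw [ρ.phi_eq_neg_add h, Submodule.map_neg]
  exact Submodule.map_add_le S _ _

theorem phi_comp_phi_comp_phi_self (i : Fin 3) :
    ρ.phi i ∘ₗ ρ.coxeter.phi i ∘ₗ ρ.coxeter.coxeter.phi i = 0 :=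
  LinearMap.ext fun η => (Submodule.mem_bot K).1 (ρ.coxeter.coxeter.phi_mem i η)

theorem phi_comp_phi_comp_phi (h : IsTriple i j k) :
    ρ.phi i ∘ₗ ρ.coxeter.phi j ∘ₗ ρ.coxeter.coxeter.phi i =
      -(ρ.phi i ∘ₗ ρ.coxeter.phi k ∘ₗ ρ.coxeter.coxeter.phi i) := by
  rw [ρ.coxeter.phi_eq_neg_add h.swap_left, LinearMap.neg_comp, LinearMap.add_comp,
    LinearMap.comp_neg, LinearMap.comp_add, ρ.phi_comp_phi_comp_phi_self, zero_add]

theorem map_phi_map_phi_map_phi (h : IsTriple i j k)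
    (S : Submodule K ρ.coxeter.coxeter.coxeterSpace) :
    ((S.map (ρ.coxeter.coxeter.phi i)).map (ρ.coxeter.phi j)).map (ρ.phi i) =
      ((S.map (ρ.coxeter.coxeter.phi i)).map (ρ.coxeter.phi k)).map (ρ.phi i) := by
  simp only [← Submodule.map_comp]
  rw [ρ.phi_comp_phi_comp_phi h, ← LinearMap.neg_comp, Submodule.map_comp, Submodule.map_neg,
    ← Submodule.map_comp]

theorem map_phi_comap_inf_comap_inf_comap (h : IsTriple i j k) (B C D : Submodule K V) :
    Submodule.map (ρ.phi i) (Submodule.comap (ρ.phi i) B ⊓ Submodule.comap (ρ.phi j) C ⊓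
      Submodule.comap (ρ.phi k) D) = ρ (y i) ⊓ B ⊓ (ρ (y j) ⊓ C ⊔ ρ (y k) ⊓ D) := by
  ext b
  simp only [Submodule.mem_map, Submodule.mem_inf, Submodule.mem_comap, Submodule.mem_sup]
  constructor
  · rintro ⟨η, ⟨⟨hB, hC⟩, hD⟩, rfl⟩
    refine ⟨⟨ρ.phi_mem i η, hB⟩, -ρ.phi j η, ⟨neg_mem (ρ.phi_mem j η), neg_mem hC⟩,
      -ρ.phi k η, ⟨neg_mem (ρ.phi_mem k η), neg_mem hD⟩, ?_⟩
    rw [ρ.phi_eq_neg_add h, LinearMap.neg_apply, LinearMap.add_apply, neg_add]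
  · rintro ⟨⟨hY, hB⟩, c, ⟨hYc, hC⟩, d, ⟨hYd, hD⟩, rfl⟩
    obtain ⟨η, hi, hj, hk⟩ := ρ.exists_phi_eq h hY (neg_mem hYc) (neg_mem hYd) (by abel)
    exact ⟨η, ⟨⟨by rwa [hi], by rw [hj]; exact neg_mem hC⟩, by rw [hk]; exact neg_mem hD⟩, hi⟩

/-- The subspace `{η | ηᵢ ∈ ρ(b), ηⱼ ∈ ρ(c), ηₖ ∈ ρ(d)}` of `X₀¹`. The values of `Φ⁺ρ` on the
admissible elements are of this form, and their images under the elementary maps are computed by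
`map_phi_box_left` and `map_phi_box_right`. -/
def box (i j k : Fin 3) (b c d : D222) : Submodule K ρ.coxeterSpace :=
  Submodule.comap (ρ.phi i) (ρ b) ⊓ Submodule.comap (ρ.phi j) (ρ c) ⊓
    Submodule.comap (ρ.phi k) (ρ d)

theorem map_phi_box_left (h : IsTriple i j k) (b c d : D222) :
    (ρ.box i j k b c d).map (ρ.phi i) = ρ (y i ⊓ b ⊓ (y j ⊓ c ⊔ y k ⊓ d)) := by
  simp only [box, ρ.map_phi_comap_inf_comap_inf_comap h, apply_inf, apply_sup]

theorem map_phi_box_right (h : IsTriple i j k) (b c d : D222) :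
    (ρ.box i j k b c d).map (ρ.phi k) = ρ (y k ⊓ d ⊓ (y i ⊓ b ⊔ y j ⊓ c)) := by
  rw [← ρ.map_phi_box_left h.rotate_right, box, box, inf_comm, inf_assoc]

theorem map_phi_top (h : IsTriple i j k) :
    Submodule.map (ρ.phi i) ⊤ = ρ (y i ⊓ (y j ⊔ y k)) := by
  simpa [box, ρ.map_top] using ρ.map_phi_box_left h ⊤ ⊤ ⊤

theorem map_phi_comap_self (h : IsTriple i j k) (b : D222) :
    Submodule.map (ρ.phi i) (Submodule.comap (ρ.phi i) (ρ b)) =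
      ρ (y i ⊓ b ⊓ (y j ⊔ y k)) := by
  simpa [box, ρ.map_top] using ρ.map_phi_box_left h b ⊤ ⊤

theorem map_phi_comap (h : IsTriple i j k) (c : D222) :
    Submodule.map (ρ.phi i) (Submodule.comap (ρ.phi j) (ρ c)) = ρ (y i ⊓ (y j ⊓ c ⊔ y k)) := by
  simpa [box, ρ.map_top] using ρ.map_phi_box_left h ⊤ c ⊤

theorem map_phi_coxeter_x_inf_comap (h : IsTriple i j k) (d : D222) :
    Submodule.map (ρ.phi i) (ρ.coxeter (x j) ⊓ Submodule.comap (ρ.phi k) (ρ d)) =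
      ρ (y i ⊓ (y k ⊓ d)) := by
  simpa [coxeter_x, apply_inf] using ρ.map_phi_comap_inf_comap_inf_comap h ⊤ ⊥ (ρ d)

theorem map_phi_comap_inf_coxeter_x (h : IsTriple i j k) (b : D222) :
    Submodule.map (ρ.phi i) (Submodule.comap (ρ.phi i) (ρ b) ⊓ ρ.coxeter (x j)) =
      ρ (y i ⊓ b ⊓ y k) := by
  simpa [coxeter_x, apply_inf] using ρ.map_phi_comap_inf_comap_inf_comap h (ρ b) ⊥ ⊤

theorem map_phi_coxeter_x (h : IsTriple i j k) :
    Submodule.map (ρ.phi i) (ρ.coxeter (x j)) = ρ (y i ⊓ y k) := by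
  simpa [ρ.map_top] using ρ.map_phi_comap_inf_coxeter_x h ⊤

theorem coxeter_x_sup (i : Fin 3) (S : Submodule K ρ.coxeterSpace) :
    ρ.coxeter (x i) ⊔ S = Submodule.comap (ρ.phi i) (S.map (ρ.phi i)) := by
  rw [Submodule.comap_map_eq, sup_comm]; rfl

theorem coxeter_eq_comap_map {b : D222} (h : x i ≤ b) :
    ρ.coxeter b = Submodule.comap (ρ.phi i) ((ρ.coxeter b).map (ρ.phi i)) := by
  rw [← coxeter_x_sup, ← coxeter_sup, sup_eq_right.2 h]

theorem comap_phi_y_inf (i : Fin 3) (b : D222) :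
    Submodule.comap (ρ.phi i) (ρ (y i ⊓ b)) = Submodule.comap (ρ.phi i) (ρ b) :=
  le_antisymm (Submodule.comap_mono (ρ.apply_mono inf_le_right))
    fun η hη => by rw [apply_inf]; exact ⟨ρ.phi_mem i η, hη⟩

theorem comap_phi_inf_y_sup_y (h : IsTriple i j k) (b : D222) :
    Submodule.comap (ρ.phi i) (ρ (b ⊓ (y j ⊔ y k))) = Submodule.comap (ρ.phi i) (ρ b) := by
  refine le_antisymm (Submodule.comap_mono (ρ.apply_mono inf_le_left)) ?_
  rw [← Submodule.map_le_iff_le_comap, ρ.map_phi_comap_self h]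
  exact ρ.apply_mono (inf_le_inf_right _ inf_le_right)

theorem map_phi_coxeter_A_succ (h : IsTriple i j k) {n : ℕ}
    (hA : ρ.coxeter (A n k i) = Submodule.comap (ρ.phi k) (ρ (a n k j))) :
    (ρ.coxeter (A (n + 1) i j)).map (ρ.phi i) = ρ (y i ⊓ a (n + 1) i k ⊓ (y j ⊔ y k)) := by
  have le_sup : y k ⊓ a n k j ⊓ y i ≤ y j ⊔ y k :=
    inf_le_left.trans (inf_le_left.trans le_sup_right)
  rw [A_succ h, coxeter_sup, Submodule.map_sup, coxeter_y, coxeter_inf, hA,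
    ρ.map_phi_comap_self h, ρ.map_phi_coxeter_x_inf_comap h, y_inf_x, ← apply_sup,
    a_succ h.swap_right, inf_comm (y i) (x i ⊔ _), sup_inf_assoc_of_le _ (x_le_y i),
    sup_comm (x i), sup_inf_assoc_of_le _ le_sup, sup_comm, inf_comm (y i)]

theorem coxeter_a_and_coxeter_A (n : ℕ) (h : IsTriple i j k) :
    ρ.coxeter (a n i j) = Submodule.comap (ρ.phi i) (ρ (A n k j)) ∧
      ρ.coxeter (A n i j) = Submodule.comap (ρ.phi i) (ρ (a n i k)) := by
  induction n generalizing i j k with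
  | zero => simp [a_zero, A_zero, map_top]
  | succ n ih =>
    constructor
    · rw [a_succ h, coxeter_sup, coxeter_x_sup, coxeter_inf, coxeter_y, (ih h.rotate_left).1,
        ← Submodule.comap_inf, ← apply_inf, ρ.map_phi_comap h, comap_phi_y_inf, A_succ h.reverse,
        y_inf_x_inf, sup_comm]
    · rw [ρ.coxeter_eq_comap_map (x_le_A _ _ _), ρ.map_phi_coxeter_A_succ h (ih h.rotate_right).2,
        ρ.comap_phi_inf_y_sup_y h, comap_phi_y_inf]

theorem coxeter_a (n : ℕ) (h : IsTriple i j k) :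
    ρ.coxeter (a n i j) = Submodule.comap (ρ.phi i) (ρ (A n k j)) :=
  (ρ.coxeter_a_and_coxeter_A n h).1

theorem coxeter_A (n : ℕ) (h : IsTriple i j k) :
    ρ.coxeter (A n i j) = Submodule.comap (ρ.phi i) (ρ (a n i k)) :=
  (ρ.coxeter_a_and_coxeter_A n h).2

theorem coxeter_x_sup_x (h : IsTriple i j k) :
    ρ.coxeter (x i ⊔ x j) = Submodule.comap (ρ.phi i) (ρ (y k)) := by
  rw [coxeter_sup, coxeter_x_sup, ρ.map_phi_coxeter_x h, comap_phi_y_inf]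

theorem coxeter_y_sup_y (h : IsTriple i j k) :
    ρ.coxeter (y j ⊔ y k) = Submodule.comap (ρ.phi j) (ρ (x j ⊔ (y i ⊔ x k))) := by
  have le_sup : (y i ⊔ x k) ⊓ y j ≤ y i ⊔ y k := inf_le_left.trans (sup_le_sup_left (x_le_y k) _)
  rw [ρ.coxeter_eq_comap_map ((x_le_y j).trans le_sup_left), coxeter_sup, Submodule.map_sup,
    coxeter_y, coxeter_y, ρ.map_phi_comap_self h.swap_left, ρ.map_phi_comap h.rotate_left, y_inf_x,
    y_inf_x, ← apply_sup, ← ρ.comap_phi_inf_y_sup_y h.swap_left (x j ⊔ _),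
    ← comap_phi_y_inf ρ j (_ ⊓ _), ← inf_assoc (y j), inf_comm (y j) (x j ⊔ _),
    sup_inf_assoc_of_le _ (x_le_y j), sup_comm (x j) (_ ⊓ _), sup_inf_assoc_of_le _ le_sup,
    sup_comm, inf_comm (y j), sup_comm (x k)]

theorem coxeter_x_sup_a_inf_A (h : IsTriple i j k) (q m : ℕ) :
    ρ.coxeter (x i ⊔ a q k j ⊓ A m k j) =
      Submodule.comap (ρ.phi i) (ρ (y j ⊔ y k ⊓ (A q i j ⊓ a m k i))) := by
  rw [coxeter_sup, coxeter_x_sup, coxeter_inf, ρ.coxeter_a q h.reverse, ρ.coxeter_A m h.reverse,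
    ← Submodule.comap_inf, ← apply_inf, ρ.map_phi_comap h.swap_right, comap_phi_y_inf, sup_comm]

theorem coxeter_y_inf_y_sup_A_inf_a (h : IsTriple i j k) (q m : ℕ) :
    ρ.coxeter (y j ⊓ y k ⊔ A q i j ⊓ a (m + 1) k i) =
      Submodule.comap (ρ.phi i) (ρ (x k ⊔ a (q + 1) j i ⊓ A (m + 1) j i)) := by
  have x_le : x i ≤ y j ⊓ y k ⊔ A q i j ⊓ a (m + 1) k i :=
    (le_inf (x_le_A _ _ _) (x_le_a_right _ _ _)).trans le_sup_right
  have map_y_inf_y : (ρ.coxeter (y j ⊓ y k)).map (ρ.phi i) = ρ (y i ⊓ (x j ⊔ x k)) := by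
    simpa [box, ρ.map_top, coxeter_inf, coxeter_y, y_inf_x] using
      ρ.map_phi_box_left h ⊤ (x j) (x k)
  have map_A_inf_a : (ρ.coxeter (A q i j ⊓ a (m + 1) k i)).map (ρ.phi i) =
      ρ (y i ⊓ a q i k ⊓ (y j ⊔ y k ⊓ A (m + 1) j i)) := by
    simpa [box, ρ.map_top, coxeter_inf, ρ.coxeter_A q h, ρ.coxeter_a (m + 1) h.rotate_right] using
      ρ.map_phi_box_left h (a q i k) ⊤ (A (m + 1) j i)
  have a_inf_A_eq : a (q + 1) j i ⊓ A (m + 1) j i = x j ⊔ y i ⊓ a q i k ⊓ A (m + 1) j i := by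
    rw [a_succ h.swap_left, sup_inf_assoc_of_le _ (x_le_A _ _ _)]
  have y_sup_eq : y j ⊔ y k ⊓ A (m + 1) j i = A (m + 1) j i ⊓ (y j ⊔ y k) := by
    rw [← sup_inf_assoc_of_le _ (y_le_A (m + 1) j i), inf_comm]
  have x_sup_x_le : x j ⊔ x k ≤ y j ⊔ y k := sup_le_sup (x_le_y j) (x_le_y k)
  rw [ρ.coxeter_eq_comap_map x_le, coxeter_sup, Submodule.map_sup, map_y_inf_y, map_A_inf_a,
    ← apply_sup, ← ρ.comap_phi_inf_y_sup_y h (x k ⊔ _), ← comap_phi_y_inf ρ i ((x k ⊔ _) ⊓ _),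
    a_inf_A_eq, y_sup_eq, ← sup_assoc, sup_comm (x k), sup_inf_assoc_of_le _ x_sup_x_le]
  simp only [inf_assoc, inf_sup_inf_self]

end Representation

/-- `φᵢ(Φ⁺ρ(b)) = ρ(b')` for every representation `ρ` over `K`. -/
def IsPhiImage (K : Type*) [Field K] (i : Fin 3) (b b' : D222) : Prop :=
  ∀ (V : Type v) [AddCommGroup V] [Module K V] (ρ : Representation K V),
    (ρ.coxeter b).map (ρ.phi i) = ρ b'

/-- The relation between the families `s = (f_α, e_α, g_{α0})` and `s' = (f_{iα}, e_{iα}, g_{iα0})`: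
the elementary map `φᵢ` carries `Φ⁺ρ(s c)` onto `ρ(s' c)`. -/
def IsSuccessor (K : Type*) [Field K] (i : Fin 3) (s s' : Fin 3 → D222) : Prop :=
  ∀ c, IsPhiImage.{v} K i (s c) (s' c)

/-- The family `(f, e, e ⊓ h)`, in which the rows of the table are expressed. -/
def values (f e h : D222) : Fin 3 → D222 := ![f, e, e ⊓ h]

theorem isSuccessor_values {K : Type*} [Field K] {i : Fin 3} {f e h f' e' h' : D222}
    (hf : IsPhiImage.{v} K i f f') (he : IsPhiImage.{v} K i e e')
    (hg : IsPhiImage.{v} K i (e ⊓ h) (e' ⊓ h')) :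
    IsSuccessor.{v} K i (values f e h) (values f' e' h') :=
  fun c => by fin_cases c <;> assumption

section Families

variable (u v w : Fin 3) (k q : ℕ)

/-- The family at `γ`, `13γ` and `3(213)γ`, with `k + 1` in place of `k` and up to a cyclic shift
of the indices. -/
def gammaEven : Fin 3 → D222 :=
  values (y u ⊓ y v ⊓ a q u w ⊓ A k w v)
    (y v ⊓ A k w v ⊓ a q v u ⊓ A (k + 1) u w ⊓ a q u w)
    (x u ⊔ a q w v ⊓ A (k + 1) w v)

/-- The family at `3γ`, `(213)γ` and `13(213)γ`, with `k + 1` in place of `k` and up to a cyclic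
shift of the indices. -/
def gammaOdd : Fin 3 → D222 :=
  values (y w ⊓ (x u ⊔ x v) ⊓ A q v w ⊓ a k w u)
    (y w ⊓ a k w u ⊓ A (q + 1) u v ⊓ a (k + 1) u v ⊓ A q v w)
    (y v ⊓ y w ⊔ A q u v ⊓ a (k + 1) w u)

/-- The family at `β`, `13β` and `3(213)β`, up to a cyclic shift of the indices. -/
def betaEven : Fin 3 → D222 :=
  values (y v ⊓ y w ⊓ a q v u ⊓ A k u w)
    (y v ⊓ A k w v ⊓ a q v u ⊓ A k u w ⊓ a (q + 1) u w)
    (x v ⊔ a q u w ⊓ A (k + 1) u w)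

/-- The family at `3β`, `(213)β` and `13(213)β`, up to a cyclic shift of the indices. -/
def betaOdd : Fin 3 → D222 :=
  values (x w ⊓ A (q + 1) u v ⊓ a k u v)
    (y w ⊓ a k w u ⊓ A (q + 1) u v ⊓ a k u v ⊓ A (q + 1) v w)
    (y u ⊓ y w ⊔ A q v w ⊓ a (k + 1) u v)

/-- The family at `1(21)^{2k}`. -/
def altEven : Fin 3 → D222 :=
  values (x u ⊓ A k v w ⊓ a k v w)
    (y u ⊓ A k w u ⊓ a k u v ⊓ A k v w ⊓ a k v w)
    (y v ⊓ a k v u ⊔ y w ⊓ a k w u)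

/-- The family at `1(21)^{2k+1}`. -/
def altOdd : Fin 3 → D222 :=
  values (y u ⊓ (x v ⊔ x w) ⊓ A k w u ⊓ a k u v)
    (y u ⊓ A k w u ⊓ a k u v ⊓ A (k + 1) v w ⊓ a (k + 1) v w)
    (y u ⊓ a (k + 1) u v ⊔ y u ⊓ a (k + 1) u w)

end Families

namespace Representation

variable {K V : Type*} [Field K] [AddCommGroup V] [Module K V] (ρ : Representation K V)
  {u v w : Fin 3}

theorem coxeter_gammaEven_f (h : IsTriple u v w) (k q : ℕ) :
    ρ.coxeter (y u ⊓ y v ⊓ a q u w ⊓ A k w v) =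
      ρ.box u v w (x u ⊓ A q v w) (x v) (a k w u) := by
  simp only [box, coxeter_y, apply_inf, Submodule.comap_inf,
    ρ.coxeter_A k h.reverse, ρ.coxeter_a q h.swap_right]
  ac_rfl

theorem coxeter_gammaEven_e (h : IsTriple u v w) (k q : ℕ) :
    ρ.coxeter (y v ⊓ A k w v ⊓ a q v u ⊓ A (k + 1) u w ⊓ a q u w) =
      ρ.box u v w (a (k + 1) u v ⊓ A q v w) (x v ⊓ A q w u) (a k w u) := by
  simp only [box, coxeter_y, apply_inf, Submodule.comap_inf,
    ρ.coxeter_A k h.reverse, ρ.coxeter_a q h.swap_left, ρ.coxeter_A (k + 1) h.swap_right,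
    ρ.coxeter_a q h.swap_right]
  ac_rfl

theorem coxeter_gammaEven_g (h : IsTriple u v w) (k q : ℕ) :
    ρ.coxeter (y v ⊓ A k w v ⊓ a q v u ⊓ A (k + 1) u w ⊓ a q u w ⊓
        (x u ⊔ a q w v ⊓ A (k + 1) w v)) =
      ρ.box u v w (a (k + 1) u v ⊓ A q v w ⊓ (y v ⊔ y w ⊓ (A q u v ⊓ a (k + 1) w u)))
        (x v ⊓ A q w u) (a k w u) := by
  rw [coxeter_inf, ρ.coxeter_gammaEven_e h, ρ.coxeter_x_sup_a_inf_A h]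
  simp only [box, apply_inf _ _ (_ ⊔ _), Submodule.comap_inf]
  ac_rfl

theorem coxeter_gammaOdd_f (h : IsTriple u v w) (k q : ℕ) :
    ρ.coxeter (y w ⊓ (x u ⊔ x v) ⊓ A q v w ⊓ a k w u) =
      ρ.box u v w (y w) (a q v u) (x w ⊓ A k v u) := by
  simp only [box, coxeter_y, apply_inf, Submodule.comap_inf, ρ.coxeter_x_sup_x h,
    ρ.coxeter_A q h.rotate_left, ρ.coxeter_a k h.rotate_right]
  ac_rfl

theorem coxeter_gammaOdd_e (h : IsTriple u v w) (k q : ℕ) :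
    ρ.coxeter (y w ⊓ a k w u ⊓ A (q + 1) u v ⊓ a (k + 1) u v ⊓ A q v w) =
      ρ.box u v w (a (q + 1) u w ⊓ A (k + 1) w v) (a q v u) (x w ⊓ A k v u) := by
  simp only [box, coxeter_y, apply_inf, Submodule.comap_inf,
    ρ.coxeter_a k h.rotate_right, ρ.coxeter_A (q + 1) h, ρ.coxeter_a (k + 1) h,
    ρ.coxeter_A q h.rotate_left]
  ac_rfl

theorem coxeter_gammaOdd_g (h : IsTriple u v w) (k q : ℕ) :
    ρ.coxeter (y w ⊓ a k w u ⊓ A (q + 1) u v ⊓ a (k + 1) u v ⊓ A q v w ⊓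
        (y v ⊓ y w ⊔ A q u v ⊓ a (k + 1) w u)) =
      ρ.box u v w (a (q + 1) u w ⊓ A (k + 1) w v ⊓ (x w ⊔ a (q + 1) v u ⊓ A (k + 1) v u))
        (a q v u) (x w ⊓ A k v u) := by
  rw [coxeter_inf, ρ.coxeter_gammaOdd_e h, ρ.coxeter_y_inf_y_sup_A_inf_a h]
  simp only [box, apply_inf _ _ (_ ⊔ _), Submodule.comap_inf]
  ac_rfl

theorem coxeter_betaEven_f (h : IsTriple u v w) (k q : ℕ) :
    ρ.coxeter (y v ⊓ y w ⊓ a q v u ⊓ A k u w) =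
      ρ.box u v w (a k u v) (x v ⊓ A q w u) (x w) := by
  simp only [box, coxeter_y, apply_inf, Submodule.comap_inf,
    ρ.coxeter_A k h.swap_right, ρ.coxeter_a q h.swap_left]
  ac_rfl

theorem coxeter_betaEven_e (h : IsTriple u v w) (k q : ℕ) :
    ρ.coxeter (y v ⊓ A k w v ⊓ a q v u ⊓ A k u w ⊓ a (q + 1) u w) =
      ρ.box u v w (a k u v ⊓ A (q + 1) v w) (x v ⊓ A q w u) (a k w u) := by
  simp only [box, coxeter_y, apply_inf, Submodule.comap_inf,
    ρ.coxeter_A k h.reverse, ρ.coxeter_A k h.swap_right, ρ.coxeter_a q h.swap_left,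
    ρ.coxeter_a (q + 1) h.swap_right]
  ac_rfl

theorem coxeter_betaEven_g (h : IsTriple u v w) (k q : ℕ) :
    ρ.coxeter (y v ⊓ A k w v ⊓ a q v u ⊓ A k u w ⊓ a (q + 1) u w ⊓
        (x v ⊔ a q u w ⊓ A (k + 1) u w)) =
      ρ.box u v w (a k u v ⊓ A (q + 1) v w)
        (x v ⊓ A q w u ⊓ (y w ⊔ y u ⊓ (A q v w ⊓ a (k + 1) u v))) (a k w u) := by
  rw [coxeter_inf, ρ.coxeter_betaEven_e h, ρ.coxeter_x_sup_a_inf_A h.rotate_left]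
  simp only [box, apply_inf _ _ (_ ⊔ _), Submodule.comap_inf]
  ac_rfl

theorem coxeter_betaOdd_e (h : IsTriple u v w) (k q : ℕ) :
    ρ.coxeter (y w ⊓ a k w u ⊓ A (q + 1) u v ⊓ a k u v ⊓ A (q + 1) v w) =
      ρ.box u v w (a (q + 1) u w ⊓ A k w v) (a (q + 1) v u) (x w ⊓ A k v u) := by
  simp only [box, coxeter_y, apply_inf, Submodule.comap_inf,
    ρ.coxeter_a k h.rotate_right, ρ.coxeter_A (q + 1) h, ρ.coxeter_a k h,
    ρ.coxeter_A (q + 1) h.rotate_left]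
  ac_rfl

theorem coxeter_betaOdd_g (h : IsTriple u v w) (k q : ℕ) :
    ρ.coxeter (y w ⊓ a k w u ⊓ A (q + 1) u v ⊓ a k u v ⊓ A (q + 1) v w ⊓
        (y u ⊓ y w ⊔ A q v w ⊓ a (k + 1) u v)) =
      ρ.box u v w (a (q + 1) u w ⊓ A k w v)
        (a (q + 1) v u ⊓ (x u ⊔ a (q + 1) w v ⊓ A (k + 1) w v)) (x w ⊓ A k v u) := by
  rw [coxeter_inf, ρ.coxeter_betaOdd_e h, inf_comm (y u),
    ρ.coxeter_y_inf_y_sup_A_inf_a h.rotate_left]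
  simp only [box, apply_inf _ _ (_ ⊔ _), Submodule.comap_inf]
  ac_rfl

end Representation

section Successors

variable (K : Type*) [Field K] {u v w : Fin 3}

theorem isSuccessor_gammaEven_gammaOdd (h : IsTriple u v w) (k q : ℕ) :
    IsSuccessor.{v} K w (gammaEven u v w k q) (gammaOdd u v w k q) := by
  have sum_eq : y u ⊓ (a (k + 1) u v ⊓ A q v w) ⊔ x v ⊓ A q w u =
      A (q + 1) u v ⊓ (a (k + 1) u v ⊓ A q v w) := by
    rw [sup_comm, x_inf_A_sup_y_inf h q (le_inf (x_le_a_right _ _ _) (x_le_A _ _ _))]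
  refine isSuccessor_values (fun V _ _ ρ => ?_) (fun V _ _ ρ => ?_) fun V _ _ ρ => ?_
  · rw [ρ.coxeter_gammaEven_f h, ρ.map_phi_box_right h, y_inf_x, y_inf_x_inf, sup_comm,
      sup_comm (x u), inf_comm (x u), inf_comm (A q v w), ← sup_inf_assoc_of_le _ (x_le_A q v w)]
    congr 1; ac_rfl
  · rw [ρ.coxeter_gammaEven_e h, ρ.map_phi_box_right h, y_inf_x_inf, sum_eq]
    congr 1; ac_rfl
  · rw [ρ.coxeter_gammaEven_g h, ρ.map_phi_box_right h, y_inf_x_inf, ← inf_assoc (y u), sup_comm,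
      ← sup_inf_assoc_of_le _ (inf_le_left.trans ((x_le_y v).trans le_sup_left)), sup_comm, sum_eq]
    have exchange := inf_sup_inf_comm (y w) (y v) (A q u v ⊓ a (k + 1) w u)
    have regroup (b c d : D222) : y w ⊓ b ⊓ (c ⊓ d) = b ⊓ c ⊓ (y w ⊓ d) := by ac_rfl
    rw [regroup, exchange]
    congr 1; ac_rfl

theorem isSuccessor_gammaEven_betaOdd (h : IsTriple u v w) (k q : ℕ) :
    IsSuccessor.{v} K u (gammaEven u v w k (q + 1)) (betaOdd v w u (k + 1) q) := by
  have sum_eq : x v ⊓ A (q + 1) w u ⊔ y w ⊓ a k w u = A (q + 1) w u ⊓ a (k + 1) v w :=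
    x_inf_sup_y_inf_a h.rotate_left k (y_le_A _ _ _)
  refine isSuccessor_values (fun V _ _ ρ => ?_) (fun V _ _ ρ => ?_) fun V _ _ ρ => ?_
  · rw [ρ.coxeter_gammaEven_f h, ρ.map_phi_box_left h, y_inf_x, y_inf_x_inf,
      ← a_succ h.rotate_left]
  · rw [ρ.coxeter_gammaEven_e h, ρ.map_phi_box_left h, y_inf_x_inf, sum_eq]
    congr 1; ac_rfl
  · rw [ρ.coxeter_gammaEven_g h, ρ.map_phi_box_left h, y_inf_x_inf, sum_eq]
    have exchange := inf_sup_inf_sup (p := x v ⊓ A q w u) (r := y w ⊓ a (k + 1) w u) (b := y u)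
      (c := y v) (inf_le_left.trans (x_le_y v))
    have sum_eq_succ := x_inf_sup_y_inf_a h.rotate_left (k + 1) (b := A q w u) (y_le_A _ _ _)
    rw [sum_eq_succ, ← A_succ h, inf_assoc (y w), inf_comm (a (k + 1) w u)] at exchange
    have regroup (b c d : D222) : y u ⊓ (b ⊓ c) ⊓ d = b ⊓ d ⊓ (y u ⊓ c) := by ac_rfl
    rw [regroup, exchange]
    congr 1; ac_rfl

theorem isSuccessor_gammaOdd_gammaEven (h : IsTriple u v w) (k q : ℕ) :
    IsSuccessor.{v} K u (gammaOdd u v w k q) (gammaEven w u v k (q + 1)) := by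
  have sum_eq : y v ⊓ a q v u ⊔ x w ⊓ A k v u = A k v u ⊓ a (q + 1) w v := by
    rw [sup_comm, x_inf_sup_y_inf_a h.reverse q (y_le_A _ _ _)]
  refine isSuccessor_values (fun V _ _ ρ => ?_) (fun V _ _ ρ => ?_) fun V _ _ ρ => ?_
  · rw [ρ.coxeter_gammaOdd_f h, ρ.map_phi_box_left h, y_inf_x_inf, sum_eq]
    congr 1; ac_rfl
  · rw [ρ.coxeter_gammaOdd_e h, ρ.map_phi_box_left h, y_inf_x_inf, sum_eq]
    congr 1; ac_rfl
  · rw [ρ.coxeter_gammaOdd_g h, ρ.map_phi_box_left h, y_inf_x_inf, sum_eq]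
    congr 1; ac_rfl

theorem isSuccessor_betaEven_betaOdd (h : IsTriple u v w) (k q : ℕ) :
    IsSuccessor.{v} K w (betaEven u v w k q) (betaOdd u v w k q) := by
  have sum_eq (b : D222) (hb : x v ≤ b) : y u ⊓ b ⊔ x v ⊓ A q w u = A (q + 1) u v ⊓ b := by
    rw [sup_comm, x_inf_A_sup_y_inf h q hb]
  refine isSuccessor_values (fun V _ _ ρ => ?_) (fun V _ _ ρ => ?_) fun V _ _ ρ => ?_
  · rw [ρ.coxeter_betaEven_f h, ρ.map_phi_box_right h, y_inf_x_inf,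
      sum_eq _ (x_le_a_right _ _ _), y_inf_x]
    congr 1; ac_rfl
  · rw [ρ.coxeter_betaEven_e h, ρ.map_phi_box_right h, y_inf_x_inf,
      sum_eq _ (le_inf (x_le_a_right _ _ _) (x_le_A _ _ _))]
    congr 1; ac_rfl
  · rw [ρ.coxeter_betaEven_g h, ρ.map_phi_box_right h, inf_assoc (x v), y_inf_x_inf,
      ← inf_assoc (x v)]
    have exchange := inf_sup_inf_sup_inf (b := y u) (c := A q v w ⊓ a (k + 1) u v) (d := y w)
      (m := y u ⊓ (a k u v ⊓ A (q + 1) v w)) (p := x v ⊓ A q w u) inf_le_left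
      (inf_le_left.trans (le_inf (x_le_A _ _ _) (x_le_a_right _ _ _)))
    rw [sum_eq _ (le_inf (x_le_a_right _ _ _) (x_le_A _ _ _))] at exchange
    rw [inf_right_comm, sup_comm (y w), exchange]
    congr 1; ac_rfl

theorem isSuccessor_betaEven_gammaOdd (h : IsTriple u v w) (k q : ℕ) :
    IsSuccessor.{v} K u (betaEven u v w k q) (gammaOdd v w u k q) := by
  have sum_eq : x v ⊓ A q w u ⊔ y w ⊓ a k w u = A q w u ⊓ a (k + 1) v w :=
    x_inf_sup_y_inf_a h.rotate_left k (y_le_A _ _ _)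
  refine isSuccessor_values (fun V _ _ ρ => ?_) (fun V _ _ ρ => ?_) fun V _ _ ρ => ?_
  · rw [ρ.coxeter_betaEven_f h, ρ.map_phi_box_left h, y_inf_x_inf, y_inf_x, sup_comm,
      ← sup_inf_assoc_of_le _ (x_le_A _ _ _), sup_comm]
    congr 1; ac_rfl
  · rw [ρ.coxeter_betaEven_e h, ρ.map_phi_box_left h, y_inf_x_inf, sum_eq]
    congr 1; ac_rfl
  · rw [ρ.coxeter_betaEven_g h, ρ.map_phi_box_left h, inf_assoc (x v), y_inf_x_inf,
      ← inf_assoc (x v), sup_comm,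
      ← sup_inf_assoc_of_le _ (inf_le_left.trans le_sup_left), sup_comm, sum_eq]
    have exchange := inf_sup_inf_comm (y u) (y w) (A q v w ⊓ a (k + 1) u v)
    have regroup (b c d : D222) : y u ⊓ b ⊓ (c ⊓ d) = b ⊓ c ⊓ (y u ⊓ d) := by ac_rfl
    rw [regroup, exchange]
    congr 1; ac_rfl

theorem isSuccessor_betaOdd_betaEven (h : IsTriple u v w) (k q : ℕ) :
    IsSuccessor.{v} K u (betaOdd u v w k q) (betaEven w u v k (q + 1)) := by
  have sum_eq : y v ⊓ a (q + 1) v u ⊔ x w ⊓ A k v u = A k v u ⊓ a (q + 2) w v := by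
    rw [sup_comm, x_inf_sup_y_inf_a h.reverse (q + 1) (y_le_A _ _ _)]
  refine isSuccessor_values (fun V _ _ ρ => ?_) (fun V _ _ ρ => ?_) fun V _ _ ρ => ?_
  · rw [inf_assoc, inf_comm (x w), ρ.coxeter_inf, ρ.coxeter_inf, ρ.coxeter_A (q + 1) h,
      ρ.coxeter_a k h, ← Submodule.comap_inf, ← ρ.apply_inf,
      ρ.map_phi_comap_inf_coxeter_x h.swap_right]
    congr 1; ac_rfl
  · rw [ρ.coxeter_betaOdd_e h, ρ.map_phi_box_left h, y_inf_x_inf, sum_eq]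
    congr 1; ac_rfl
  · rw [ρ.coxeter_betaOdd_g h, ρ.map_phi_box_left h, y_inf_x_inf, ← inf_assoc (y v), sup_comm,
      ← sup_inf_assoc_of_le _, sup_comm, sum_eq]
    · congr 1; ac_rfl
    · exact inf_le_left.trans ((le_inf (x_le_a _ _ _) (x_le_A _ _ _)).trans le_sup_right)

end Successors

/-- Two families are linearly equivalent over `K` if every representation over `K` takes the same
values on them. -/
def LinearlyEquivalent (K : Type*) [Field K] (s t : Fin 3 → D222) : Prop :=
  ∀ (V : Type v) [AddCommGroup V] [Module K V] (ρ : Representation K V) (c : Fin 3),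
    ρ (s c) = ρ (t c)

namespace IsSuccessor

variable {K : Type*} [Field K] {i j k : Fin 3} {s s₀ s₁ s₂ t₀ t₁ t₂ : Fin 3 → D222}

theorem of_linearlyEquivalent (E : LinearlyEquivalent.{v} K s₀ t₀)
    (H : IsSuccessor.{v} K i t₀ t₁) : IsSuccessor.{v} K i s₀ t₁ :=
  fun c V _ _ ρ => by rw [E _ ρ.coxeter, H c V ρ]

theorem unique (H : IsSuccessor.{v} K i s s₁) (G : IsSuccessor.{v} K i s s₂) :
    LinearlyEquivalent.{v} K s₁ s₂ :=
  fun V _ _ ρ c => by rw [← H c V ρ, G c V ρ]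

theorem replace (h : IsTriple i j k) (H₀ : IsSuccessor.{v} K i s s₀)
    (H₁ : IsSuccessor.{v} K j s₀ s₁) (G₁ : IsSuccessor.{v} K k s₀ t₁)
    (G₂ : IsSuccessor.{v} K i t₁ t₂) : IsSuccessor.{v} K i s₁ t₂ := by
  intro c V _ _ ρ
  rw [← H₁ c _ ρ.coxeter, ← G₂ c V ρ, ← G₁ c _ ρ.coxeter, ← H₀ c _ ρ.coxeter.coxeter]
  exact ρ.map_phi_map_phi_map_phi h _

end IsSuccessor

section AlternatingFamilies

variable {u v w : Fin 3}

theorem values_congr {f e h f' e' h' : D222} (hf : f = f') (he : e = e')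
    (hg : e ⊓ h = e ⊓ h') : values f e h = values f' e' h' := by
  subst hf he; simp only [values, hg]

theorem A_inf_y_inf_a_sup_y_inf_a_le (h : IsTriple u v w) (k : ℕ) :
    A k w u ⊓ (y v ⊓ a (k + 1) v u ⊔ y w ⊓ a (k + 1) w u) ≤
      y v ⊓ y u ⊔ A k w u ⊓ a (k + 2) v w := by
  have y_inf_a_eq : y v ⊓ a (k + 1) v u = x v ⊔ y u ⊓ y v ⊓ a k u w := by
    rw [a_succ h.swap_left, inf_comm (y v), sup_inf_assoc_of_le _ (x_le_y v), inf_right_comm]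
  have le_A : y u ⊓ y v ⊓ a k u w ⊔ y w ⊓ a (k + 1) w u ≤ A k w u :=
    sup_le (y_inf_y_inf_a_le_A h k) (inf_le_left.trans (y_le_A k w u))
  rw [y_inf_a_eq, sup_assoc, inf_comm, sup_comm (x v), sup_inf_assoc_of_le _ le_A,
    ← x_inf_sup_y_inf_a h.rotate_left (k + 1) (y_le_A k w u), inf_comm (y v)]
  exact sup_le (sup_le (inf_le_left.trans le_sup_left) (le_sup_right.trans le_sup_right))
    (le_sup_left.trans le_sup_right)

theorem y_inf_y_inf_A_inf_a_le (h : IsTriple u v w) (k : ℕ) :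
    y v ⊓ y u ⊓ (A k w u ⊓ a (k + 1) v w) ≤ y v ⊓ a (k + 1) v u := by
  refine le_inf (inf_le_left.trans inf_le_left) ?_
  have le_inf_A : y v ⊓ y u ⊓ (A k w u ⊓ a (k + 1) v w) ≤
      (x v ⊓ A k w u ⊔ y v ⊓ y w ⊓ a k w u) ⊓ A (k + 1) u v := by
    refine le_inf ?_ (inf_le_left.trans (inf_le_right.trans (y_le_A _ _ _)))
    rw [← x_inf_sup_y_inf_a h.rotate_left k (y_le_A k w u), inf_assoc (y v) (y w),
      inf_comm (y v) (y w ⊓ _), ← sup_inf_assoc_of_le _ (inf_le_left.trans (x_le_y v)), inf_comm]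
    exact inf_le_inf_left _ inf_le_left
  have x_inf_A_le : x v ⊓ A k w u ≤ A (k + 1) u v := (A_succ h k).symm ▸ le_sup_right
  refine le_inf_A.trans ?_
  rw [sup_inf_assoc_of_le _ x_inf_A_le]
  exact sup_le (inf_le_left.trans (x_le_a _ _ _)) (y_inf_y_inf_a_inf_A_le_a h k)

theorem A_inf_a_inf_y_inf_y_sup_le (h : IsTriple u v w) (k : ℕ) :
    A k w u ⊓ a (k + 1) v w ⊓ (y v ⊓ y u ⊔ A k w u ⊓ a (k + 2) v w) ≤
      y v ⊓ a (k + 1) v u ⊔ y w ⊓ a (k + 1) w u := by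
  have le_a : A k w u ⊓ a (k + 2) v w ≤ A k w u ⊓ a (k + 1) v w :=
    inf_le_inf_left _ (a_succ_le _ _ _)
  rw [inf_comm, sup_comm, sup_inf_assoc_of_le _ le_a,
    ← x_inf_sup_y_inf_a h.rotate_left (k + 1) (y_le_A k w u)]
  exact sup_le (sup_le_sup_right (inf_le_left.trans (le_inf (x_le_y v) (x_le_a _ _ _))) _)
    ((y_inf_y_inf_A_inf_a_le h k).trans le_sup_left)

theorem altEven_succ (h : IsTriple u v w) (k : ℕ) :
    altEven u v w (k + 1) = betaOdd v w u (k + 1) k := by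
  have e_le_A : y u ⊓ A (k + 1) w u ⊓ a (k + 1) u v ⊓ A (k + 1) v w ⊓ a (k + 1) v w ≤ A k w u :=
    inf_le_left.trans (inf_le_left.trans (inf_le_left.trans
      (inf_le_right.trans (A_succ_le k w u))))
  refine values_congr rfl (by ac_rfl) (le_antisymm (le_inf inf_le_left ?_) (le_inf inf_le_left ?_))
  · exact (inf_le_inf_right _ e_le_A).trans (A_inf_y_inf_a_sup_y_inf_a_le h k)
  · exact (inf_le_inf_right _ (le_inf e_le_A inf_le_right)).trans (A_inf_a_inf_y_inf_y_sup_le h k)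

theorem A_inf_y_inf_a_sup_le (h : IsTriple u v w) (k : ℕ) :
    A k v w ⊓ (y u ⊓ a (k + 1) u v ⊔ y u ⊓ a (k + 1) u w) ≤
      y w ⊓ y u ⊔ A k v w ⊓ a (k + 1) u v := by
  have y_inf_a_eq : y u ⊓ a (k + 1) u w = x u ⊔ y w ⊓ y u ⊓ a k w v := by
    rw [a_succ h.swap_right, inf_comm (y u), sup_inf_assoc_of_le _ (x_le_y u), inf_right_comm]
  rw [y_inf_a_eq, ← sup_assoc, sup_eq_left.2 (le_inf (x_le_y u) (x_le_a (k + 1) u v)), inf_comm,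
    sup_comm, sup_inf_assoc_of_le _ (y_inf_y_inf_a_le_A h.rotate_right k)]
  exact sup_le (inf_le_left.trans le_sup_left)
    ((le_inf inf_le_right (inf_le_left.trans inf_le_right)).trans le_sup_right)

theorem y_inf_y_inf_a_inf_A_le_a_succ (h : IsTriple u v w) (k : ℕ) :
    y w ⊓ y u ⊓ (a k u v ⊓ A k v w) ≤ a (k + 1) u w := by
  refine le_trans (le_inf (inf_le_left.trans inf_le_left) ?_) (y_inf_a_le_a_succ h.swap_right k)
  cases k with
  | zero => exact le_top
  | succ k =>
    refine le_trans ?_ (y_inf_y_inf_a_inf_A_le_a h.rotate_left k)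
    exact le_inf (le_inf inf_le_left (inf_le_right.trans (inf_le_left.trans (a_succ_le k u v))))
      (inf_le_right.trans inf_le_right)

theorem y_inf_a_inf_A_inf_sup_le (h : IsTriple u v w) (k : ℕ) :
    y u ⊓ a k u v ⊓ A k v w ⊓ (y w ⊓ y u ⊔ A k v w ⊓ a (k + 1) u v) ≤
      y u ⊓ a (k + 1) u v ⊔ y u ⊓ a (k + 1) u w := by
  have le_inf_sup : y u ⊓ a k u v ⊓ A k v w ⊓ (y w ⊓ y u ⊔ A k v w ⊓ a (k + 1) u v) ≤
      (A k v w ⊓ a (k + 1) u v ⊓ y u ⊔ y w ⊓ y u) ⊓ (a k u v ⊓ A k v w) := by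
    refine le_inf ?_ (inf_le_left.trans (inf_le_inf_right _ inf_le_right))
    rw [sup_comm _ (y w ⊓ y u), ← sup_inf_assoc_of_le _ inf_le_right]
    exact le_inf inf_le_right (inf_le_left.trans (inf_le_left.trans inf_le_left))
  have le_a : A k v w ⊓ a (k + 1) u v ⊓ y u ≤ a k u v ⊓ A k v w :=
    inf_le_left.trans (le_inf (inf_le_right.trans (a_succ_le k u v)) inf_le_left)
  refine le_inf_sup.trans ?_
  rw [sup_inf_assoc_of_le _ le_a]
  exact sup_le_sup (le_inf inf_le_right (inf_le_left.trans inf_le_right))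
    (le_inf (inf_le_left.trans inf_le_right) (y_inf_y_inf_a_inf_A_le_a_succ h k))

theorem altOdd_eq (h : IsTriple u v w) (k : ℕ) : altOdd u v w k = gammaOdd v w u k k := by
  refine values_congr (by ac_rfl) (by ac_rfl)
    (le_antisymm (le_inf inf_le_left ?_) (le_inf inf_le_left ?_))
  · have e_le_A : y u ⊓ A k w u ⊓ a k u v ⊓ A (k + 1) v w ⊓ a (k + 1) v w ≤ A k v w :=
      inf_le_left.trans (inf_le_right.trans (A_succ_le k v w))
    exact (inf_le_inf_right _ e_le_A).trans (A_inf_y_inf_a_sup_le h k)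
  · have e_le : y u ⊓ A k w u ⊓ a k u v ⊓ A (k + 1) v w ⊓ a (k + 1) v w ≤
        y u ⊓ a k u v ⊓ A k v w :=
      inf_le_left.trans (inf_le_inf (inf_le_inf_right _ inf_le_left) (A_succ_le k v w))
    exact (inf_le_inf_right _ e_le).trans (y_inf_a_inf_A_inf_sup_le h k)

theorem altEven_zero_swap (u v w : Fin 3) : altEven u v w 0 = altEven u w v 0 :=
  values_congr rfl rfl (congrArg _ (sup_comm _ _))

theorem altOdd_zero_swap (h : IsTriple u v w) : altOdd u v w 0 = altOdd u w v 0 := by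
  simp only [altOdd, a_zero, A_zero, inf_top_eq, zero_add, a_succ h, a_succ h.swap_right,
    a_succ h.rotate_left, a_succ h.reverse, A_succ h.rotate_left, A_succ h.reverse]
  exact values_congr (by rw [sup_comm (x v)])
    (by rw [inf_assoc, inf_comm (y v ⊔ x w), sup_comm (x v), sup_comm (y v), ← inf_assoc])
    (by rw [sup_comm (y u ⊓ _)])

end AlternatingFamilies

section AlternatingSuccessors

variable (K : Type*) [Field K] {u v w : Fin 3}

theorem isSuccessor_altEven_zero_betaEven (h : IsTriple u v w) :
    IsSuccessor.{v} K v (altEven u v w 0) (betaEven u v w 0 0) := by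
  refine isSuccessor_values (fun V _ _ ρ => ?_) (fun V _ _ ρ => ?_) fun V _ _ ρ => ?_
  · simp only [a_zero, A_zero, inf_top_eq]
    rw [ρ.map_phi_coxeter_x h.swap_left]
  · simp only [a_zero, A_zero, inf_top_eq, a_succ h.swap_right]
    rw [ρ.coxeter_y, ρ.map_phi_comap h.swap_left, y_inf_x]
  · simp only [a_zero, A_zero, inf_top_eq, top_inf_eq, a_succ h.swap_right, A_succ h.swap_right]
    have map_box := ρ.map_phi_box_left h.swap_left (x v ⊔ (y u ⊔ x w)) (x u) ⊤
    simp only [Representation.box, ρ.map_top, Submodule.comap_top, inf_top_eq, y_inf_x] at map_box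
    rw [ρ.coxeter_inf, ρ.coxeter_y_sup_y h, ρ.coxeter_y, inf_comm, map_box, inf_right_comm]

theorem isSuccessor_altEven_betaEven (h : IsTriple u v w) (k : ℕ) :
    IsSuccessor.{v} K v (altEven u v w k) (betaEven u v w k k) := by
  cases k with
  | zero => exact isSuccessor_altEven_zero_betaEven K h
  | succ k => exact altEven_succ h k ▸ isSuccessor_betaOdd_betaEven K h.rotate_left (k + 1) k

theorem isSuccessor_betaEven_altOdd (h : IsTriple u v w) (k : ℕ) :
    IsSuccessor.{v} K u (betaEven u v w k k) (altOdd u v w k) :=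
  altOdd_eq h k ▸ isSuccessor_betaEven_gammaOdd K h k k

theorem isSuccessor_altOdd_gammaEven (h : IsTriple u v w) (k : ℕ) :
    IsSuccessor.{v} K v (altOdd u v w k) (gammaEven u v w k (k + 1)) :=
  altOdd_eq h k ▸ isSuccessor_gammaOdd_gammaEven K h.rotate_left k k

theorem isSuccessor_gammaEven_altEven (h : IsTriple u v w) (k : ℕ) :
    IsSuccessor.{v} K u (gammaEven u v w k (k + 1)) (altEven u v w (k + 1)) :=
  altEven_succ h k ▸ isSuccessor_gammaEven_betaOdd K h k k

theorem isSuccessor_gammaOdd_betaEven (h : IsTriple u v w) (k q : ℕ) :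
    IsSuccessor.{v} K v (gammaOdd u v w k (q + 1)) (betaEven u v w (k + 1) (q + 1)) :=
  .replace h.rotate_left (isSuccessor_gammaOdd_gammaEven K h.rotate_left k q)
    (isSuccessor_gammaEven_gammaOdd K h k (q + 1)) (isSuccessor_gammaEven_betaOdd K h k q)
    (isSuccessor_betaOdd_betaEven K h.rotate_left (k + 1) q)

theorem isSuccessor_betaOdd_gammaEven (h : IsTriple u v w) {k q : ℕ} (hk : k ≤ q) :
    IsSuccessor.{v} K v (betaOdd u v w k q) (gammaEven u v w k (q + 1)) := by
  obtain ⟨s, hs⟩ : ∃ s, IsSuccessor.{v} K v s (betaEven u v w k q) := by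
    cases q with
    | zero =>
      obtain rfl : k = 0 := Nat.le_zero.1 hk
      exact ⟨_, isSuccessor_altEven_betaEven K h 0⟩
    | succ q => exact ⟨_, isSuccessor_betaOdd_betaEven K h.rotate_left k q⟩
  exact .replace h.rotate_left hs (isSuccessor_betaEven_betaOdd K h k q)
    (isSuccessor_betaEven_gammaOdd K h k q) (isSuccessor_gammaOdd_gammaEven K h.rotate_left k q)

theorem linearlyEquivalent_altEven_and_altOdd (h : IsTriple u v w) (k : ℕ) :
    LinearlyEquivalent.{v} K (altEven u v w k) (altEven u w v k) ∧
      LinearlyEquivalent.{v} K (altOdd u v w k) (altOdd u w v k) := by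
  induction k with
  | zero =>
    rw [altEven_zero_swap, altOdd_zero_swap h]
    exact ⟨fun _ _ _ _ _ => rfl, fun _ _ _ _ _ => rfl⟩
  | succ k ih =>
    have altEven_swap : LinearlyEquivalent.{v} K (altEven u v w (k + 1)) (altEven u w v (k + 1)) :=
      (isSuccessor_gammaEven_altEven K h k).unique <|
        .replace h (isSuccessor_betaEven_altOdd K h k) (isSuccessor_altOdd_gammaEven K h k)
          (.of_linearlyEquivalent ih.2 (isSuccessor_altOdd_gammaEven K h.swap_right k))
          (isSuccessor_gammaEven_altEven K h.swap_right k)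
    have altOdd_swap : LinearlyEquivalent.{v} K (altOdd u v w (k + 1)) (altOdd u w v (k + 1)) :=
      (isSuccessor_betaEven_altOdd K h (k + 1)).unique <|
        .replace h (isSuccessor_gammaEven_altEven K h k) (isSuccessor_altEven_betaEven K h (k + 1))
          (.of_linearlyEquivalent altEven_swap
            (isSuccessor_altEven_betaEven K h.swap_right (k + 1)))
          (isSuccessor_betaEven_altOdd K h.swap_right (k + 1))
    exact ⟨altEven_swap, altOdd_swap⟩

theorem isSuccessor_altEven_betaEven_swap (h : IsTriple u v w) (k : ℕ) :
    IsSuccessor.{v} K w (altEven u v w k) (betaEven u w v k k) :=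
  .of_linearlyEquivalent (linearlyEquivalent_altEven_and_altOdd K h k).1
    (isSuccessor_altEven_betaEven K h.swap_right k)

theorem isSuccessor_altOdd_gammaEven_swap (h : IsTriple u v w) (k : ℕ) :
    IsSuccessor.{v} K w (altOdd u v w k) (gammaEven u w v k (k + 1)) :=
  .of_linearlyEquivalent (linearlyEquivalent_altEven_and_altOdd K h k).2
    (isSuccessor_altOdd_gammaEven K h.swap_right k)

end AlternatingSuccessors

/-- The triple obtained from `(i, j, l)` by `m` cyclic shifts `(i, j, l) ↦ (j, l, i)` begins with
`t`. -/
def StartsAt (t : Fin 3) : ℕ → Fin 3 → Fin 3 → Fin 3 → Prop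
  | 0, i, _, _ => i = t
  | m + 1, i, j, l => StartsAt t m j l i

theorem startsAt_three_mul {t : Fin 3} (p : ℕ) {i j l : Fin 3} :
    StartsAt t (3 * p) i j l ↔ i = t := by
  induction p with
  | zero => exact Iff.rfl
  | succ _ ih => exact ih

/-- `s` is the family `(f_α, e_α, g_{α0})` of an admissible sequence `α` of length `n` that starts
at `t`. In the first four cases `α` is, up to a permutation of the indices, a prefix of length `2m`
or `2m + 1` followed by `(21)^{2k+2}` or `(21)^{2k+1}`. -/
inductive IsFamily (t : Fin 3) (n : ℕ) : (Fin 3 → D222) → Prop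
  | gammaEven {i j l : Fin 3} {k q m : ℕ} (h : IsTriple i j l) (hm : StartsAt t m i j l)
      (hq : q = k + m + 1) (hn : n = 4 * k + 2 * m + 4) : IsFamily t n (gammaEven i j l k q)
  | gammaOdd {i j l : Fin 3} {k q m : ℕ} (h : IsTriple i j l) (hm : StartsAt t m i j l)
      (hq : q = k + m + 1) (hn : n = 4 * k + 2 * m + 5) : IsFamily t n (gammaOdd i j l k q)
  | betaEven {i j l : Fin 3} {k q m : ℕ} (h : IsTriple i j l) (hm : StartsAt t m i j l)
      (hq : q = k + m) (hn : n = 4 * k + 2 * m + 2) : IsFamily t n (betaEven i j l k q)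
  | betaOdd {i j l : Fin 3} {k q m : ℕ} (h : IsTriple i j l) (hm : StartsAt t m i j l)
      (hq : q = k + m) (hn : n = 4 * k + 2 * m + 3) : IsFamily t n (betaOdd i j l k q)
  | altEven {j l : Fin 3} {k : ℕ} (h : IsTriple t j l) (hn : n = 4 * k + 1) :
      IsFamily t n (altEven t j l k)
  | altOdd {j l : Fin 3} {k : ℕ} (h : IsTriple t j l) (hn : n = 4 * k + 3) :
      IsFamily t n (altOdd t j l k)

namespace IsFamily

variable {t : Fin 3} {n : ℕ} {s : Fin 3 → D222} (K : Type*) [Field K]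

theorem exists_isSuccessor_gammaEven {i j l : Fin 3} (h : IsTriple i j l) (k : ℕ) {m : ℕ}
    (hm : StartsAt t m i j l) : ∃ s, IsFamily t (4 * k + 2 * m + 5) s ∧
      IsSuccessor.{v} K i (D222.gammaEven i j l k (k + m + 1)) s := by
  cases m with
  | zero =>
    obtain rfl : i = t := hm
    exact ⟨_, .altEven h (by lia), isSuccessor_gammaEven_altEven K h k⟩
  | succ m =>
    exact ⟨_, .betaOdd h.rotate_left hm (by lia) (by lia), isSuccessor_gammaEven_betaOdd K h k _⟩

theorem exists_isSuccessor_betaEven {i j l : Fin 3} (h : IsTriple i j l) (k : ℕ) {m : ℕ}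
    (hm : StartsAt t m i j l) : ∃ s, IsFamily t (4 * k + 2 * m + 3) s ∧
      IsSuccessor.{v} K i (D222.betaEven i j l k (k + m)) s := by
  cases m with
  | zero =>
    obtain rfl : i = t := hm
    exact ⟨_, .altOdd h (by lia), isSuccessor_betaEven_altOdd K h k⟩
  | succ m =>
    exact ⟨_, .gammaOdd h.rotate_left hm (by lia) (by lia), isSuccessor_betaEven_gammaOdd K h k _⟩

theorem exists_isSuccessor (H : IsFamily t n s) : ∃ i j l s' s'', IsTriple i j l ∧
    IsFamily t (n + 1) s' ∧ IsFamily t (n + 1) s'' ∧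
      IsSuccessor.{v} K i s s' ∧ IsSuccessor.{v} K j s s'' := by
  cases H with
  | @gammaEven i j l k q m h hm hq hn =>
    subst hq hn
    obtain ⟨s', hs', succ'⟩ := exists_isSuccessor_gammaEven.{v} K h k hm
    exact ⟨i, l, j, s', _, h.swap_right, hs', .gammaOdd h hm rfl rfl, succ',
      isSuccessor_gammaEven_gammaOdd K h k _⟩
  | @gammaOdd i j l k q m h hm hq hn =>
    subst hq
    exact ⟨i, j, l, _, _, h, .gammaEven (m := m + 1) h.rotate_right hm (by lia) (by lia),
      .betaEven (k := k + 1) h hm (by lia) (by lia),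
      isSuccessor_gammaOdd_gammaEven K h k _, isSuccessor_gammaOdd_betaEven K h k _⟩
  | @betaEven i j l k q m h hm hq hn =>
    subst hq hn
    obtain ⟨s', hs', succ'⟩ := exists_isSuccessor_betaEven.{v} K h k hm
    exact ⟨i, l, j, s', _, h.swap_right, hs', .betaOdd h hm rfl rfl, succ',
      isSuccessor_betaEven_betaOdd K h k _⟩
  | @betaOdd i j l k q m h hm hq hn =>
    exact ⟨i, j, l, _, _, h, .betaEven (m := m + 1) h.rotate_right hm (by lia) (by lia),
      .gammaEven h hm (by lia) (by lia),
      isSuccessor_betaOdd_betaEven K h k q, isSuccessor_betaOdd_gammaEven K h (by lia)⟩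
  | @altEven j l k h hn =>
    exact ⟨j, l, t, _, _, h.rotate_left, .betaEven (m := 0) h rfl rfl (by lia),
      .betaEven (m := 0) h.swap_right rfl rfl (by lia),
      isSuccessor_altEven_betaEven K h k, isSuccessor_altEven_betaEven_swap K h k⟩
  | @altOdd j l k h hn =>
    exact ⟨j, l, t, _, _, h.rotate_left, .gammaEven (m := 0) h rfl rfl (by lia),
      .gammaEven (m := 0) h.swap_right rfl rfl (by lia),
      isSuccessor_altOdd_gammaEven K h k, isSuccessor_altOdd_gammaEven_swap K h k⟩

theorem exists_isSuccessor_of_succ (H : IsFamily t (n + 1) s) (hn : 1 ≤ n) :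
    ∃ i s', IsFamily t n s' ∧ IsSuccessor.{v} K i s' s := by
  cases H with
  | @gammaEven i j l k q m h hm hq hn' =>
    subst hq
    exact ⟨j, _, .betaOdd h hm rfl (by lia), isSuccessor_betaOdd_gammaEven K h (by lia)⟩
  | @gammaOdd i j l k q m h hm hq hn' =>
    exact ⟨l, _, .gammaEven h hm hq (by lia), isSuccessor_gammaEven_gammaOdd K h k q⟩
  | @betaEven i j l k q m h hm hq hn' =>
    subst hq
    cases m with
    | zero =>
      obtain rfl : i = t := hm
      exact ⟨j, _, .altEven h (by lia), isSuccessor_altEven_betaEven K h k⟩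
    | succ m =>
      exact ⟨j, _, .betaOdd h.rotate_left hm rfl (by lia),
        isSuccessor_betaOdd_betaEven K h.rotate_left k _⟩
  | @betaOdd i j l k q m h hm hq hn' =>
    exact ⟨l, _, .betaEven h hm hq (by lia), isSuccessor_betaEven_betaOdd K h k q⟩
  | @altEven j l k h hn' =>
    obtain ⟨k, rfl⟩ : ∃ k', k = k' + 1 := Nat.exists_eq_add_one.2 (by lia)
    exact ⟨t, _, .gammaEven (m := 0) h rfl rfl (by lia), isSuccessor_gammaEven_altEven K h k⟩
  | @altOdd j l k h hn' =>
    exact ⟨t, _, .betaEven (m := 0) h rfl rfl (by lia), isSuccessor_betaEven_altOdd K h k⟩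

end IsFamily

/-- `α` is an admissible sequence that starts at `u` and ends at `v`. A sequence `i_n … i_1` is
written as the list `[i_n, …, i_1]`, so `v` is its head and `u` its last entry. -/
def IsAdmissibleFrom (u v : Fin 3) (α : List (Fin 3)) : Prop :=
  IsAdmissible α ∧ α.head? = some v ∧ α.getLast? = some u

namespace IsAdmissibleFrom

variable {u v w : Fin 3}

theorem cons {α : List (Fin 3)} (H : IsAdmissibleFrom u v α) (h : w ≠ v) :
    IsAdmissibleFrom u w (w :: α) := by
  refine ⟨H.1.cons fun z hz => ?_, rfl, ?_⟩
  · rwa [Option.some_inj.1 (hz.symm.trans H.2.1)]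
  · rw [List.getLast?_cons, H.2.2, Option.getD_some]

theorem cons_power (h : u ≠ v) (m : ℕ) : IsAdmissibleFrom u u (u :: power [v, u] m) :=
  ⟨isChain_power h m, rfl, getLast_power u v m⟩

theorem power_append_power (h : IsTriple u v w) (p r : ℕ) :
    IsAdmissibleFrom u v (power [v, u, w] p ++ power [v, u] (r + 1)) := by
  have power_succ (s : List (Fin 3)) (m : ℕ) : power s (m + 1) = s ++ power s m := by
    simp [power, List.replicate_succ]
  induction p with
  | zero =>
    rw [power_succ]
    exact (cons_power h.1 r).cons h.1.symm
  | succ p ih =>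
    rw [power_succ, List.append_assoc]
    exact ((ih.cons h.2.2.symm).cons h.2.1).cons h.1.symm

end IsAdmissibleFrom

section Table

variable {u v w : Fin 3}

theorem exists_isAdmissibleFrom_table (h : IsTriple u v w) (k p : ℕ) (N : Fin 14)
    (hk : (N : ℕ) < 6 → 0 < k) : ∃ i, IsAdmissibleFrom u i (table u v w k p N).α := by
  have prefixes {δ : List (Fin 3)} (H0 : IsAdmissibleFrom u v δ) :
      IsAdmissibleFrom u w (w :: δ) ∧ IsAdmissibleFrom u u (u :: w :: δ) ∧
      IsAdmissibleFrom u v (v :: u :: w :: δ) ∧ IsAdmissibleFrom u w (w :: v :: u :: w :: δ) ∧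
      IsAdmissibleFrom u u (u :: w :: v :: u :: w :: δ) :=
    have H1 := H0.cons h.2.2.symm
    have H2 := H1.cons h.2.1
    have H3 := H2.cons h.1.symm
    have H4 := H3.cons h.2.2.symm
    ⟨H1, H2, H3, H4, H4.cons h.2.1⟩
  have hβ : IsAdmissibleFrom u v (power [v, u, w] (2 * p) ++ power [v, u] (2 * k + 1)) :=
    .power_append_power h _ _
  have hγ (hk : 0 < k) :
      IsAdmissibleFrom u v (power [v, u, w] (2 * p) ++ power [v, u] (2 * k)) := by
    obtain ⟨k, rfl⟩ := Nat.exists_eq_add_one.2 hk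
    exact .power_append_power h _ (2 * k + 1)
  match N, hk with
  | 0, hk => exact ⟨v, hγ (hk (by decide))⟩
  | 1, hk => exact ⟨w, (prefixes (hγ (hk (by decide)))).1⟩
  | 2, hk => exact ⟨u, (prefixes (hγ (hk (by decide)))).2.1⟩
  | 3, hk => exact ⟨v, (prefixes (hγ (hk (by decide)))).2.2.1⟩
  | 4, hk => exact ⟨w, (prefixes (hγ (hk (by decide)))).2.2.2.1⟩
  | 5, hk => exact ⟨u, (prefixes (hγ (hk (by decide)))).2.2.2.2⟩
  | 6, _ => exact ⟨u, .cons_power h.1 _⟩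
  | 7, _ => exact ⟨u, .cons_power h.1 _⟩
  | 8, _ => exact ⟨v, hβ⟩
  | 9, _ => exact ⟨w, (prefixes hβ).1⟩
  | 10, _ => exact ⟨u, (prefixes hβ).2.1⟩
  | 11, _ => exact ⟨v, (prefixes hβ).2.2.1⟩
  | 12, _ => exact ⟨w, (prefixes hβ).2.2.2.1⟩
  | 13, _ => exact ⟨u, (prefixes hβ).2.2.2.2⟩

theorem length_table (u v w : Fin 3) (k p : ℕ) (N : Fin 14) : (table u v w k p N).α.length =
    ![4 * k + 6 * p, 4 * k + 6 * p + 1, 4 * k + 6 * p + 2, 4 * k + 6 * p + 3, 4 * k + 6 * p + 4,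
      4 * k + 6 * p + 5, 2 * (2 * k) + 1, 2 * (2 * k + 1) + 1, 4 * k + 6 * p + 2, 4 * k + 6 * p + 3,
      4 * k + 6 * p + 4, 4 * k + 6 * p + 5, 4 * k + 6 * p + 6, 4 * k + 6 * p + 7] N := by
  have hγ : (power [v, u, w] (2 * p) ++ power [v, u] (2 * k)).length = 4 * k + 6 * p := by
    simp only [List.length_append, length_power, List.length_cons, List.length_nil]
    lia
  have hβ : (power [v, u, w] (2 * p) ++ power [v, u] (2 * k + 1)).length = 4 * k + 6 * p + 2 := by
    simp only [List.length_append, length_power, List.length_cons, List.length_nil]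
    lia
  have halt (m : ℕ) : (u :: power [v, u] m).length = 2 * m + 1 := by
    simp only [length_power, List.length_cons, List.length_nil]
    lia
  match N with
  | 0 => exact hγ
  | 1 => exact congrArg (· + 1) hγ
  | 2 => exact congrArg (· + 2) hγ
  | 3 => exact congrArg (· + 3) hγ
  | 4 => exact congrArg (· + 4) hγ
  | 5 => exact congrArg (· + 5) hγ
  | 6 => exact halt (2 * k)
  | 7 => exact halt (2 * k + 1)
  | 8 => exact hβ
  | 9 => exact congrArg (· + 1) hβ
  | 10 => exact congrArg (· + 2) hβ
  | 11 => exact congrArg (· + 3) hβ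
  | 12 => exact congrArg (· + 4) hβ
  | 13 => exact congrArg (· + 5) hβ

/-- The family `(f_α, e_α, g_{α0})` of a row of the table. -/
def AdmissibleData.family (d : AdmissibleData) : Fin 3 → D222 := ![d.f, d.e, d.g]

theorem family_table_five (u v w : Fin 3) (k p : ℕ) :
    (table u v w (k + 1) p 5).family = gammaOdd v w u k (k + 1 + 3 * p + 2) := by
  rw [gammaOdd, inf_comm (y w)]
  rfl

theorem family_table_eleven (u v w : Fin 3) (k p : ℕ) :
    (table u v w k p 11).family = betaOdd w u v k (k + 3 * p + 1) := by
  rw [betaOdd, inf_comm (y w)]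
  rfl

theorem family_table_thirteen (u v w : Fin 3) (k p : ℕ) :
    (table u v w k p 13).family = betaOdd v w u k (k + 3 * p + 2) := by
  rw [betaOdd, inf_comm (y v) (y u)]
  rfl

theorem isFamily_table (h : IsTriple u v w) (k p : ℕ) (N : Fin 14)
    (hk : (N : ℕ) < 6 → 0 < k) :
    IsFamily u (table u v w k p N).α.length (table u v w k p N).family := by
  have hm : StartsAt u (3 * p) u v w := (startsAt_three_mul p).2 rfl
  have hm' : StartsAt u (3 * p + 1) w u v := hm
  have hm'' : StartsAt u (3 * p + 2) v w u := hm
  have h' := h.rotate_right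
  have h'' := h.rotate_left
  rw [length_table]
  match N, k, hk with
  | 0, 0, hk | 1, 0, hk | 2, 0, hk | 3, 0, hk | 4, 0, hk | 5, 0, hk =>
    exact absurd (hk (by decide)) (lt_irrefl 0)
  | 0, k + 1, _ => exact .gammaEven (q := k + 1 + 3 * p) h hm (by lia) (by simp +arith)
  | 1, k + 1, _ => exact .gammaOdd (q := k + 1 + 3 * p) h hm (by lia) (by simp +arith)
  | 2, k + 1, _ => exact .gammaEven (q := k + 1 + 3 * p + 1) h' hm' (by lia) (by simp +arith)
  | 3, k + 1, _ => exact .gammaOdd (q := k + 1 + 3 * p + 1) h' hm' (by lia) (by simp +arith)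
  | 4, k + 1, _ => exact .gammaEven (q := k + 1 + 3 * p + 2) h'' hm'' (by lia) (by simp +arith)
  | 5, k + 1, _ => exact family_table_five .. ▸ .gammaOdd h'' hm'' (by lia) (by simp +arith)
  | 6, k, _ => exact .altEven h (by simp +arith)
  | 7, k, _ => exact .altOdd h (by simp +arith)
  | 8, k, _ => exact .betaEven (q := k + 3 * p) h hm (by lia) (by simp +arith)
  | 9, k, _ => exact .betaOdd (q := k + 3 * p) h hm (by lia) (by simp +arith)
  | 10, k, _ => exact .betaEven (q := k + 3 * p + 1) h' hm' (by lia) (by simp +arith)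
  | 11, k, _ => exact family_table_eleven .. ▸ .betaOdd h' hm' (by lia) (by simp +arith)
  | 12, k, _ => exact .betaEven (q := k + 3 * p + 2) h'' hm'' (by lia) (by simp +arith)
  | 13, k, _ => exact family_table_thirteen .. ▸ .betaOdd h'' hm'' (by lia) (by simp +arith)

theorem StartsAt.exists_eq {t i j l : Fin 3} {m : ℕ} (H : StartsAt t m i j l) :
    ∃ p, m = 3 * p ∧ i = t ∨ m = 3 * p + 1 ∧ j = t ∨ m = 3 * p + 2 ∧ l = t := by
  obtain ⟨p, rfl | rfl | rfl⟩ : ∃ p, m = 3 * p ∨ m = 3 * p + 1 ∨ m = 3 * p + 2 := ⟨m / 3, by lia⟩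
  · exact ⟨p, .inl ⟨rfl, (startsAt_three_mul p).1 H⟩⟩
  · exact ⟨p, .inr (.inl ⟨rfl, (startsAt_three_mul p).1 H⟩)⟩
  · exact ⟨p, .inr (.inr ⟨rfl, (startsAt_three_mul p).1 H⟩)⟩

theorem IsFamily.exists_table {t : Fin 3} {n : ℕ} {s : Fin 3 → D222} (H : IsFamily t n s) :
    ∃ v w k p, ∃ N : Fin 14, IsTriple t v w ∧ ((N : ℕ) < 6 → 0 < k) ∧
      ((N : ℕ) = 6 ∨ (N : ℕ) = 7 → p = 0) ∧ (table t v w k p N).α.length = n ∧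
        (table t v w k p N).family = s := by
  simp only [length_table]
  cases H with
  | @gammaEven i j l k q m h hm hq hn =>
    obtain ⟨p, ⟨rfl, rfl⟩ | ⟨rfl, rfl⟩ | ⟨rfl, rfl⟩⟩ := hm.exists_eq
    · obtain rfl : q = k + 1 + 3 * p := by lia
      exact ⟨j, l, k + 1, p, 0, h, by simp, by simp, by simp +arith [hn], rfl⟩
    · obtain rfl : q = k + 1 + 3 * p + 1 := by lia
      exact ⟨l, i, k + 1, p, 2, h.rotate_left, by simp, by simp, by simp +arith [hn], rfl⟩
    · obtain rfl : q = k + 1 + 3 * p + 2 := by lia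
      exact ⟨i, j, k + 1, p, 4, h.rotate_right, by simp, by simp, by simp +arith [hn], rfl⟩
  | @gammaOdd i j l k q m h hm hq hn =>
    obtain ⟨p, ⟨rfl, rfl⟩ | ⟨rfl, rfl⟩ | ⟨rfl, rfl⟩⟩ := hm.exists_eq
    · obtain rfl : q = k + 1 + 3 * p := by lia
      exact ⟨j, l, k + 1, p, 1, h, by simp, by simp, by simp +arith [hn], rfl⟩
    · obtain rfl : q = k + 1 + 3 * p + 1 := by lia
      exact ⟨l, i, k + 1, p, 3, h.rotate_left, by simp, by simp, by simp +arith [hn], rfl⟩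
    · obtain rfl : q = k + 1 + 3 * p + 2 := by lia
      exact ⟨i, j, k + 1, p, 5, h.rotate_right, by simp, by simp, by simp +arith [hn],
        family_table_five ..⟩
  | @betaEven i j l k q m h hm hq hn =>
    subst hq
    obtain ⟨p, ⟨rfl, rfl⟩ | ⟨rfl, rfl⟩ | ⟨rfl, rfl⟩⟩ := hm.exists_eq
    · exact ⟨j, l, k, p, 8, h, by simp, by simp, by simp +arith [hn], rfl⟩
    · exact ⟨l, i, k, p, 10, h.rotate_left, by simp, by simp, by simp +arith [hn], rfl⟩
    · exact ⟨i, j, k, p, 12, h.rotate_right, by simp, by simp, by simp +arith [hn], rfl⟩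
  | @betaOdd i j l k q m h hm hq hn =>
    subst hq
    obtain ⟨p, ⟨rfl, rfl⟩ | ⟨rfl, rfl⟩ | ⟨rfl, rfl⟩⟩ := hm.exists_eq
    · exact ⟨j, l, k, p, 9, h, by simp, by simp, by simp +arith [hn], rfl⟩
    · exact ⟨l, i, k, p, 11, h.rotate_left, by simp, by simp, by simp +arith [hn],
        family_table_eleven ..⟩
    · exact ⟨i, j, k, p, 13, h.rotate_right, by simp, by simp, by simp +arith [hn],
        family_table_thirteen ..⟩
  | @altEven j l k h hn => exact ⟨j, l, k, 0, 6, h, by simp, by simp, by simp +arith [hn], rfl⟩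
  | @altOdd j l k h hn => exact ⟨j, l, k, 0, 7, h, by simp, by simp, by simp +arith [hn], rfl⟩

end Table

theorem IsTriple.of_perm (σ : Equiv.Perm (Fin 3)) : IsTriple (σ 0) (σ 1) (σ 2) :=
  ⟨σ.injective.ne (by decide), σ.injective.ne (by decide), σ.injective.ne (by decide)⟩

theorem IsTriple.exists_perm {u v w : Fin 3} (h : IsTriple u v w) :
    ∃ σ : Equiv.Perm (Fin 3), σ 0 = u ∧ σ 1 = v ∧ σ 2 = w := by
  revert u v w
  unfold IsTriple
  decide

theorem SeqEquiv.getLast?_eq {α β : List (Fin 3)} (h : SeqEquiv α β) :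
    α.getLast? = β.getLast? := by
  induction h with
  | rel _ _ h =>
    cases h
    simp [List.getLast?_append, List.getLast?_cons]
  | refl => rfl
  | symm _ _ _ h => exact h.symm
  | trans _ _ _ _ _ h k => exact h.trans k

theorem AdmissibleElements.exists_isFamily {α : List (Fin 3)} {f e g : D222}
    (H : AdmissibleElements α f e g) :
    ∃ t, α.getLast? = some t ∧ IsFamily t α.length ![f, e, g] := by
  obtain ⟨-, _, ⟨σ, k, p, N, hk, -, rfl⟩, hα, rfl, rfl, rfl⟩ := H
  obtain ⟨_, -, -, hlast⟩ := exists_isAdmissibleFrom_table (IsTriple.of_perm σ) k p N hk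
  exact ⟨σ 0, hα.getLast?_eq.trans hlast,
    hα.length_eq ▸ isFamily_table (IsTriple.of_perm σ) k p N hk⟩

theorem AdmissibleElements.isFamily {α : List (Fin 3)} {f e g : D222} {t : Fin 3}
    (H : AdmissibleElements α f e g) (ht : α.getLast? = some t) :
    IsFamily t α.length ![f, e, g] := by
  obtain ⟨t', ht', hs⟩ := H.exists_isFamily
  rwa [Option.some_inj.1 (ht.symm.trans ht')]

theorem IsFamily.exists_admissibleElements {t : Fin 3} {n : ℕ} {s : Fin 3 → D222}
    (H : IsFamily t n s) :
    ∃ α, AdmissibleElements α (s 0) (s 1) (s 2) ∧ α.length = n ∧ α.getLast? = some t := by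
  obtain ⟨v, w, k, p, N, h, hk, hp, hn, rfl⟩ := H.exists_table
  obtain ⟨σ, rfl, rfl, rfl⟩ := h.exists_perm
  obtain ⟨_, hadm, -, hlast⟩ := exists_isAdmissibleFrom_table h k p N hk
  exact ⟨_, ⟨hadm, _, ⟨σ, k, p, N, hk, hp, rfl⟩, .refl _, rfl, rfl, rfl⟩, hn, hlast⟩

theorem fSet_eq_image (t : Fin 3) (n : ℕ) : fSet t n = (· 0) '' {s | IsFamily t n s} := by
  ext z
  constructor
  · rintro ⟨α, e, g, h, rfl, ht⟩
    exact ⟨_, h.isFamily ht, rfl⟩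
  · rintro ⟨s, h, rfl⟩
    obtain ⟨α, hα⟩ := h.exists_admissibleElements
    exact ⟨α, _, _, hα⟩

theorem eSet_eq_image (t : Fin 3) (n : ℕ) : eSet t n = (· 1) '' {s | IsFamily t n s} := by
  ext z
  constructor
  · rintro ⟨α, e, g, h, rfl, ht⟩
    exact ⟨_, h.isFamily ht, rfl⟩
  · rintro ⟨s, h, rfl⟩
    obtain ⟨α, hα⟩ := h.exists_admissibleElements
    exact ⟨α, _, _, hα⟩

theorem IsFamily.one_le {t : Fin 3} {n : ℕ} {s : Fin 3 → D222} (H : IsFamily t n s) : 1 ≤ n := by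
  cases H <;> lia

theorem gSet_succ {n : ℕ} (hn : 1 ≤ n) :
    gSet (n + 1) = ⋃ t, (· 2) '' {s | IsFamily t n s} := by
  ext z
  rw [Set.mem_iUnion]
  constructor
  · rintro (⟨hn', -⟩ | ⟨α, f, e, h, hl⟩)
    · lia
    · obtain rfl : α.length = n := by lia
      obtain ⟨t, -, hs⟩ := h.exists_isFamily
      exact ⟨t, _, hs, rfl⟩
  · rintro ⟨t, s, h, rfl⟩
    obtain ⟨α, hα, hl, -⟩ := h.exists_admissibleElements
    exact .inr ⟨α, _, _, hα, by rw [hl]⟩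

theorem gSet_one : gSet 1 = {⊤} := by
  ext z
  constructor
  · rintro (⟨-, rfl⟩ | ⟨α, f, e, h, hl⟩)
    · rfl
    · obtain ⟨t, -, hs⟩ := h.exists_isFamily
      have := hs.one_le
      lia
  · rintro rfl
    exact .inl ⟨rfl, rfl⟩

theorem IsFamily.exists_eq_altEven_zero {t : Fin 3} {s : Fin 3 → D222} (H : IsFamily t 1 s) :
    ∃ j l, IsTriple t j l ∧ s = D222.altEven t j l 0 := by
  generalize hN : 1 = N at H
  cases H with
  | @altEven j l k h hn =>
    obtain rfl : k = 0 := by lia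
    exact ⟨j, l, h, rfl⟩
  | _ => lia

theorem Representation.apply_sum {K V : Type*} [Field K] [AddCommGroup V] [Module K V]
    (ρ : Representation K V) (S : Set D222) (hS : S.Finite) (hne : S.Nonempty) :
    ρ (sum S hS hne) = ⨆ z ∈ S, ρ z := by
  rw [sum]
  refine (Finset.apply_sup'_eq_sup'_comp _ ρ.toHom (map_sup ρ.toHom)).trans ?_
  rw [Finset.sup'_eq_sup, Finset.sup_eq_iSup]
  simp only [Set.Finite.mem_toFinset]
  rfl

/-- Every element of `S` has images in `T` under two of the elementary maps `φ₁, φ₂, φ₃`, and every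
element of `T` is such an image. This is the relation between the summands of `z_t(n)` and of
`z_t(n + 1)`. -/
structure IsNextLayer (K : Type*) [Field K] (S T : Set D222) : Prop where
  exists_images : ∀ z ∈ S, ∃ i j l, IsTriple i j l ∧
    (∃ z' ∈ T, IsPhiImage.{v} K i z z') ∧ ∃ z'' ∈ T, IsPhiImage.{v} K j z z''
  exists_preimage : ∀ z' ∈ T, ∃ i, ∃ z ∈ S, IsPhiImage.{v} K i z z'

section IsNextLayer

variable (K : Type*) [Field K]

theorem isNextLayer_image_isFamily (t : Fin 3) {n : ℕ} (hn : 1 ≤ n) (c : Fin 3) :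
    IsNextLayer.{v} K ((· c) '' {s | IsFamily t n s}) ((· c) '' {s | IsFamily t (n + 1) s}) where
  exists_images := by
    rintro _ ⟨s, hs, rfl⟩
    obtain ⟨i, j, l, s', s'', h, hs', hs'', succ', succ''⟩ := hs.exists_isSuccessor.{v} K
    exact ⟨i, j, l, h, ⟨_, ⟨s', hs', rfl⟩, succ' c⟩, ⟨_, ⟨s'', hs'', rfl⟩, succ'' c⟩⟩
  exists_preimage := by
    rintro _ ⟨s', hs', rfl⟩
    obtain ⟨i, s, hs, succ⟩ := hs'.exists_isSuccessor_of_succ.{v} K hn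
    exact ⟨i, _, ⟨s, hs, rfl⟩, succ c⟩

variable {K}

theorem IsNextLayer.iUnion {ι : Sort*} {S T : ι → Set D222}
    (H : ∀ t, IsNextLayer.{v} K (S t) (T t)) : IsNextLayer.{v} K (⋃ t, S t) (⋃ t, T t) where
  exists_images z hz := by
    obtain ⟨t, ht⟩ := Set.mem_iUnion.1 hz
    obtain ⟨i, j, l, h, ⟨z', hz', H'⟩, z'', hz'', H''⟩ := (H t).exists_images z ht
    exact ⟨i, j, l, h, ⟨z', Set.mem_iUnion_of_mem t hz', H'⟩,
      z'', Set.mem_iUnion_of_mem t hz'', H''⟩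
  exists_preimage z' hz' := by
    obtain ⟨t, ht⟩ := Set.mem_iUnion.1 hz'
    obtain ⟨i, z, hz, H'⟩ := (H t).exists_preimage z' ht
    exact ⟨i, z, Set.mem_iUnion_of_mem t hz, H'⟩

variable (K)

theorem isPhiImage_top_altEven_zero {i j l : Fin 3} (h : IsTriple i j l) :
    IsPhiImage.{v} K i ⊤ (altEven i j l 0 2) := fun V _ _ ρ => by
  rw [ρ.coxeter.map_top, ρ.map_phi_top h]
  simp [altEven, values, a_zero, A_zero]

theorem isNextLayer_top :
    IsNextLayer.{v} K {⊤} (⋃ t, (· 2) '' {s | IsFamily t 1 s}) where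
  exists_images := by
    have image {i j l : Fin 3} (h : IsTriple i j l) :
        ∃ z ∈ ⋃ t, (· 2) '' {s | IsFamily t 1 s}, IsPhiImage.{v} K i ⊤ z :=
      ⟨_, Set.mem_iUnion_of_mem i ⟨_, .altEven (k := 0) h rfl, rfl⟩,
        isPhiImage_top_altEven_zero K h⟩
    rintro _ rfl
    have h : IsTriple 0 1 2 := ⟨by decide, by decide, by decide⟩
    exact ⟨0, 1, 2, h, image h, image h.rotate_left⟩
  exists_preimage z' hz' := by
    obtain ⟨t, s, hs, rfl⟩ := Set.mem_iUnion.1 hz'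
    obtain ⟨j, l, h, rfl⟩ := hs.exists_eq_altEven_zero
    exact ⟨t, ⊤, rfl, isPhiImage_top_altEven_zero K h⟩

theorem isNextLayer_fSet (t : Fin 3) {n : ℕ} (hn : 1 ≤ n) :
    IsNextLayer.{v} K (fSet t n) (fSet t (n + 1)) := by
  rw [fSet_eq_image, fSet_eq_image]
  exact isNextLayer_image_isFamily K t hn 0

theorem isNextLayer_eSet (t : Fin 3) {n : ℕ} (hn : 1 ≤ n) :
    IsNextLayer.{v} K (eSet t n) (eSet t (n + 1)) := by
  rw [eSet_eq_image, eSet_eq_image]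
  exact isNextLayer_image_isFamily K t hn 1

theorem isNextLayer_gSet {n : ℕ} (hn : 1 ≤ n) :
    IsNextLayer.{v} K (gSet n) (gSet (n + 1)) := by
  rw [gSet_succ hn]
  obtain _ | _ | n := n
  · lia
  · rw [gSet_one]
    exact isNextLayer_top K
  · rw [gSet_succ (Nat.le_add_left 1 n)]
    exact .iUnion fun t => isNextLayer_image_isFamily K t (Nat.le_add_left 1 n) 2

variable {K}

theorem IsNextLayer.iSup_map_phi_sum {V : Type v} [AddCommGroup V] [Module K V]
    {S T : Set D222} (H : IsNextLayer.{v} K S T) (ρ : Representation K V)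
    (hS : S.Finite) (nS : S.Nonempty) (hT : T.Finite) (nT : T.Nonempty) :
    ⨆ i : Fin 3, (ρ.coxeter (sum S hS nS)).map (ρ.phi i) = ρ (sum T hT nT) := by
  simp only [Representation.apply_sum, Submodule.map_iSup]
  refine le_antisymm (iSup_le fun r => iSup₂_le fun z hz => ?_) (iSup₂_le fun z' hz' => ?_)
  · obtain ⟨i, j, l, h, ⟨z', hz', H'⟩, z'', hz'', H''⟩ := H.exists_images z hz
    have map_phi_i : (ρ.coxeter z).map (ρ.phi i) ≤ ⨆ z ∈ T, ρ z :=
      (H' V ρ).trans_le (le_biSup (fun z => ρ z) hz')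
    have map_phi_j : (ρ.coxeter z).map (ρ.phi j) ≤ ⨆ z ∈ T, ρ z :=
      (H'' V ρ).trans_le (le_biSup (fun z => ρ z) hz'')
    rcases h.eq_or r with rfl | rfl | rfl
    · exact map_phi_i
    · exact map_phi_j
    · exact (ρ.map_phi_le_sup h.rotate_right _).trans (sup_le map_phi_i map_phi_j)
  · obtain ⟨i, z, hz, H'⟩ := H.exists_preimage z' hz'
    rw [← H' V ρ]
    exact le_iSup_of_le i (le_biSup (fun z => (ρ.coxeter z).map (ρ.phi i)) hz)

end IsNextLayer

end D222

theorem mainTheorem9 {K V : Type*} [Field K] [AddCommGroup V] [Module K V]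
    (ρ : D222.Representation K V) (n : ℕ) (hn : 1 ≤ n) :
    (∀ t : Fin 3,
      (⨆ i : Fin 3, (ρ.coxeter (D222.cumX t n hn)).map (ρ.phi i)) =
        ρ (D222.cumX t (n + 1) (Nat.le_add_left 1 n))) ∧
    (∀ t : Fin 3,
      (⨆ i : Fin 3, (ρ.coxeter (D222.cumY t n hn)).map (ρ.phi i)) =
        ρ (D222.cumY t (n + 1) (Nat.le_add_left 1 n))) ∧
    (⨆ i : Fin 3, (ρ.coxeter (D222.cumX0 n hn)).map (ρ.phi i)) =
      ρ (D222.cumX0 (n + 1) (Nat.le_add_left 1 n)) :=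
  ⟨fun t => (D222.isNextLayer_fSet K t hn).iSup_map_phi_sum ρ _ _ _ _,
    fun t => (D222.isNextLayer_eSet K t hn).iSup_map_phi_sum ρ _ _ _ _,
    (D222.isNextLayer_gSet K hn).iSup_map_phi_sum ρ _ _ _ _⟩
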